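/- **Setting.** Let $g\ge 1$ and let $\pi_1$ be the fundamental group of a compact oriented surface of genus $g$ with one boundary component: the free group on $\mathbf u_1,\mathbf v_1,\dots,\mathbf u_g,\mathbf v_g$, with boundary word $\partial=\prod_{i=1}^g[\mathbf u_i,\mathbf v_i]$. By Dehn–Nielsen the mapping class group is $\mathcal M_{g,1}=\{\varphi\in\mathrm{Aut}(\pi_1):\varphi(\partial)=\partial\}$. Put $\Gamma_0=\pi_1$, $\Gamma_{k+1}=[\Gamma_k,\pi_1]$, and let $\mathcal M_{g,1}[m]$ be the subgroup of those $\varphi\in\mathcal M_{g,1}$ that act trivially on $\pi_1/\Gamma_m$. Let $H=H_1(\pi_1;\mathbb Q)$, write $x=[\mathbf x]\in H$ for the class of $\mathbf x\in\pi_1$, let $\widehat T=\prod_{n\ge0}H^{\otimes n}$, and let $\mathcal L_n\subset H^{\otimes n}$ be the degree $n$ part of the free Lie algebra on $H$. *Johnson homomorphism.* For $\varphi\in\mathcal M_{g,1}[m]$, $\tau_m(\varphi)\in\mathrm{Hom}(H,\mathcal L_{m+1})$ is the linear map that sends $[\mathbf x]$ to the class of $\varphi(\mathbf x)\mathbf x^{-1}$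 under $\Gamma_m\to\Gamma_m/\Gamma_{m+1}\to\mathcal L_{m+1}$ (Magnus: commutators go to Lie brackets, and $\Gamma_0\to\mathcal L_1=H$ is $\mathbf x\mapsto[\mathbf x]$). *Marked fatgraphs.* A trivalent bordered fatgraph $G$ of genus $g$ is a connected finite graph with cyclic orderings of the half-edges at its vertices, one boundary cycle (an oriented edge pointing to $v$ is followed by the outgoing orientation of the next edge at $v$), $\chi(G)=1-2g$, one univalent vertex, and all other vertices trivalent; the tail $\mathbf t$ is the edge at the univalent vertex, oriented away from it. A marking of $G$ assigns to every oriented edge $\mathbf e$ an element of $\pi_1$, also denoted $\mathbf e$, such that $\bar{\mathbf e}\,\mathbf e=1$; $\mathbf e_1\mathbf e_2\mathbf e_3=1$ for the cyclically ordered oriented edges pointing to any trivalent vertex; these elements generate $\pi_1$; and $\bar{\mathbf t}=\partial$. For $\varphi\in\mathcal M_{g,1}$, $\varphi(G)$ is $G$ with its marking composed with $\varphi$. A (marked) Whitehead move $G\to G'$ collapses a non-tail edge with distinct endpoints and expands the resulting four-valent vertex in the other possible way, keeping the marking of all other edges. *Fatgraph Magnus expansion.* Let $h(X,Y)=\log(e^Xe^Y)-X-Y$.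 For oriented edges $\mathbf x$ of $G$ define $\ell^G(\mathbf x)=\sum_n\ell^G_n(\mathbf x)\in\widehat T$ recursively by $\ell^G_0(\mathbf x)=0$, $\ell^G_1(\mathbf x)=x$ and, for $n\ge2$, $$\ell^G_n(\mathbf x)=-\tfrac13\sum_{i=1}^r h\big(\ell^G(\mathbf f_{i-1}),-\ell^G(\mathbf f_i)\big)_{(n)}$$ if the edge-path $\mathbf x=\mathbf f_0,\mathbf f_1,\dots,\mathbf f_r=\bar{\mathbf x}$ along the boundary cycle does not pass through the univalent vertex, and $\ell^G_n(\mathbf x)=-\ell^G_n(\bar{\mathbf x})$ otherwise. The fatgraph Magnus expansion $\theta^G=\sum_n\theta^G_n$, with $\theta^G_n(\mathbf x)\in H^{\otimes n}$, is the homomorphism from $\pi_1$ to the multiplicative group $1+\prod_{n\ge1}H^{\otimes n}$ with $\theta^G_1(\mathbf x)=x$ for all $\mathbf x\in\pi_1$ and $\theta^G(\mathbf e)=\exp(\ell^G(\mathbf e))$ for all oriented edges $\mathbf e$ of $G$. **Corollary 4.3.** Let $m\ge1$, let $\varphi\in\mathcal M_{g,1}[m]$, and let $G=G_0\to G_1\to\dots\to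 G_k=\varphi(G)$ be a sequence of Whitehead moves of marked trivalent bordered fatgraphs of genus $g$ (the last equality up to isomorphism of marked fatgraphs). Then $\tau_m(\varphi)$ and $\theta^{G_0},\dots,\theta^{G_k}$ are well defined (they exist and are unique), and for all $\mathbf x\in\pi_1$ $$\tau_m(\varphi)(x)=\sum_{i=1}^k\big(\theta^{G_{i-1}}_{m+1}(\mathbf x)-\theta^{G_i}_{m+1}(\mathbf x)\big)\in H^{\otimes(m+1)}.$$ -/

import Mathlib

open scoped TensorProduct commutatorElement

noncomputable section

namespace FatgraphJohnson

/-! Exponential, logarithm and Hausdorff series of noncommutative power series -/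

section Series

variable {A : Type*} [Ring A] [Algebra ℚ A]

/-- `exp f = ∑ₖ fᵏ / k!`, for a power series `f` without constant term (so that `fᵏ` does not
contribute to the coefficients of degree `n < k`). -/
def expSeries (f : PowerSeries A) : PowerSeries A :=
  PowerSeries.mk fun n =>
    ∑ k ∈ Finset.range (n + 1), ((k.factorial : ℚ)⁻¹) • PowerSeries.coeff n (f ^ k)

/-- `log f = ∑ₖ (-1)ᵏ⁺¹ (f - 1)ᵏ / k`, for a power series `f` with constant term `1`. -/
def logSeries (f : PowerSeries A) : PowerSeries A :=
  PowerSeries.mk fun n =>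
    ∑ k ∈ Finset.Icc 1 n, ((-1 : ℚ) ^ (k + 1) / (k : ℚ)) • PowerSeries.coeff n ((f - 1) ^ k)

/-- The nonlinear part of the Hausdorff series: `h(X, Y) = log (exp X * exp Y) - X - Y`. -/
def hausdorff (X Y : PowerSeries A) : PowerSeries A :=
  logSeries (expSeries X * expSeries Y) - X - Y

end Series

/-! The surface group, the mapping class group and the Torelli groups -/

/-- The fundamental group of a surface of genus `g` with one boundary component: the free group
on `u₁, …, u_g` (left summand) and `v₁, …, v_g` (right summand). -/
abbrev SurfaceGroup (g : ℕ) : Type := FreeGroup (Fin g ⊕ Fin g)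

/-- The boundary word `∂ = [u₁, v₁] [u₂, v₂] ⋯ [u_g, v_g]`. -/
def boundaryWord (g : ℕ) : SurfaceGroup g :=
  (List.ofFn fun i : Fin g => ⁅(FreeGroup.of (Sum.inl i) : SurfaceGroup g), (FreeGroup.of (Sum.inr i) : SurfaceGroup g)⁆).prod

/-- The mapping class group (Dehn-Nielsen): automorphisms of the surface group that fix `∂`. -/
def mappingClassGroup (g : ℕ) : Subgroup (MulAut (SurfaceGroup g)) :=
  MulAction.stabilizer (MulAut (SurfaceGroup g)) (boundaryWord g)

/-- The `k`-th Torelli group: mapping classes acting trivially on `N_k = π₁ / Γ_k`, where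
`Γ_0 = π₁` and `Γ_{k+1} = [Γ_k, π₁]`. -/
def torelli (g k : ℕ) : Subgroup (mappingClassGroup g) where
  carrier := {φ | ∀ x : SurfaceGroup g,
    ((φ.1 x : SurfaceGroup g) : SurfaceGroup g ⧸ (⊤ : Subgroup (SurfaceGroup g)).lowerCentralSeries k) =
      ((x : SurfaceGroup g) : SurfaceGroup g ⧸ (⊤ : Subgroup (SurfaceGroup g)).lowerCentralSeries k)}
  one_mem' := fun _ => rfl
  mul_mem' := fun {φ ψ} hφ hψ x => (hφ (ψ.1 x)).trans (hψ x)
  inv_mem' := fun {φ} hφ x => by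
    have h := hφ (φ.1⁻¹ x)
    rw [MulAut.apply_inv_self] at h
    exact h.symm

/-- Rational homology `H = H₁(Σ; ℚ)`. -/
abbrev Homology (g : ℕ) : Type := ℚ ⊗[ℤ] Additive (Abelianization (SurfaceGroup g))

/-- The homology class `[x] ∈ H` of `x ∈ π₁`. -/
def homologyClass {g : ℕ} (x : SurfaceGroup g) : Homology g :=
  (1 : ℚ) ⊗ₜ[ℤ] Additive.ofMul (Abelianization.of x)

/-- The tensor algebra `T = ⨁ₙ H^{⊗ n}`; its summand `H^{⊗ n}` is `LinearMap.range ι ^ n`, where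
`ι : H → T` is the inclusion. -/
abbrev Tensors (g : ℕ) : Type := TensorAlgebra ℚ (Homology g)

/-- The completed tensor algebra `∏ₙ H^{⊗ n}` is realized inside the power series ring `T⟦X⟧`, as
the subring of all `∑ₙ tₙ Xⁿ` with `tₙ ∈ H^{⊗ n}` (see `IsHomogeneous`): the `n`-th coefficient
is the graded component of degree `n`. -/
abbrev TensorSeries (g : ℕ) : Type := PowerSeries (Tensors g)

/-- `f` belongs to the completed tensor algebra: its `n`-th coefficient lies in `H^{⊗ n}`. -/
def IsHomogeneous {g : ℕ} (f : TensorSeries g) : Prop :=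
  ∀ n : ℕ, PowerSeries.coeff n f ∈
    (LinearMap.range (TensorAlgebra.ι ℚ (M := Homology g)) : Submodule ℚ (Tensors g)) ^ n

/-- Generalized Magnus expansions: homomorphisms from `π₁` to the multiplicative group
`1 + T̂₁` of the completed tensor algebra `T̂` such that `θ(x) = 1 + [x] + θ₂(x) + θ₃(x) + ⋯`. -/
structure IsMagnusExpansion {g : ℕ} (θ : SurfaceGroup g →* TensorSeries g) : Prop where
  homogeneous : ∀ x, IsHomogeneous (θ x)
  coeff_zero : ∀ x, PowerSeries.coeff 0 (θ x) = 1
  coeff_one : ∀ x, PowerSeries.coeff 1 (θ x) = TensorAlgebra.ι ℚ (homologyClass x)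

/-! The Johnson homomorphisms -/

/-- `IsLieClass k x u` says that `x ∈ Γ_k` and that `u ∈ 𝓛_{k+1} ⊆ H^{⊗ (k+1)}` is the image of `x`
under the Magnus map `Γ_k → Γ_k / Γ_{k+1} → 𝓛_{k+1}` to the free Lie algebra `𝓛` on `H`.
These maps are the homomorphisms that send `x ∈ Γ_0` to `[x]` and turn group commutators
`[x, y]`, with `x ∈ Γ_k` and `y ∈ π₁`, into Lie brackets. -/
inductive IsLieClass {g : ℕ} : ℕ → SurfaceGroup g → Tensors g → Prop
  | of (x : SurfaceGroup g) : IsLieClass 0 x (TensorAlgebra.ι ℚ (homologyClass x))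
  | commutator {k : ℕ} {x : SurfaceGroup g} {u : Tensors g} (y : SurfaceGroup g) :
      IsLieClass k x u → IsLieClass (k + 1) ⁅x, y⁆ ⁅u, TensorAlgebra.ι ℚ (homologyClass y)⁆
  | mul {k : ℕ} {x y : SurfaceGroup g} {u v : Tensors g} :
      IsLieClass k x u → IsLieClass k y v → IsLieClass k (x * y) (u + v)
  | inv {k : ℕ} {x : SurfaceGroup g} {u : Tensors g} :
      IsLieClass k x u → IsLieClass k x⁻¹ (-u)

/-- `τ : H → 𝓛_{m+1} ⊆ T` is the `m`-th Johnson homomorphism evaluated at `φ`: for all `x ∈ π₁`,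
`τ [x]` is the class of `φ(x) x⁻¹` in `Γ_m / Γ_{m+1} → 𝓛_{m+1}`. -/
def IsJohnson {g : ℕ} (m : ℕ) (φ : mappingClassGroup g) (τ : Homology g →ₗ[ℚ] Tensors g) : Prop :=
  ∀ x : SurfaceGroup g, IsLieClass m (φ.1 x * x⁻¹) (τ (homologyClass x))

/-- The value `τ_m(φ)` of the `m`-th Johnson homomorphism at `φ`, that is, the unique
`τ` with `IsJohnson m φ τ`. -/
def johnson {g : ℕ} (m : ℕ) (φ : mappingClassGroup g) : Homology g →ₗ[ℚ] Tensors g :=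
  Classical.epsilon (IsJohnson m φ)

/-! Trivalent marked bordered fatgraphs -/

/-- A trivalent once-bordered fatgraph of genus `g` with a `π`-marking, given by its finite set
`Dart` of oriented edges. A dart is regarded as pointing towards its end vertex, so that the
vertices are the cycles of `rot`, the cyclic ordering of the darts pointing to a vertex. -/
structure MarkedFatgraph (g : ℕ) where
  Dart : Type
  finite_dart : Finite Dart
  /-- orientation reversal -/
  bar : Equiv.Perm Dart
  bar_bar : ∀ e, bar (bar e) = e
  bar_ne : ∀ e, bar e ≠ e
  /-- the next dart in the cyclic order at the vertex that a dart points to -/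
  rot : Equiv.Perm Dart
  /-- the tail, oriented away from its univalent vertex -/
  tail : Dart
  /-- there is exactly one univalent vertex, and the tail is the edge incident to it -/
  univalent_iff : ∀ e, rot e = e ↔ e = bar tail
  /-- all other vertices are trivalent -/
  trivalent : ∀ e, e ≠ bar tail → rot (rot (rot e)) = e
  /-- there is exactly one boundary cycle (it consists of all darts), a dart pointing
  to `v` being followed by the outgoing orientation of the next one at `v`; in particular the
  graph is connected -/
  one_boundary : ∀ e, ∃ n : ℕ, ((rot.trans bar) ^ n) tail = e
  /-- gluing a disk to the boundary cycle gives a closed surface of genus `g`: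
  `V - E + 1 = 2 - 2g` -/
  genus : (Nat.card (Quotient (Equiv.Perm.SameCycle.setoid rot)) : ℤ)
    - Nat.card (Quotient (Equiv.Perm.SameCycle.setoid bar)) + 1 = 2 - 2 * (g : ℤ)
  /-- the `π`-marking -/
  mark : Dart → SurfaceGroup g
  mark_bar : ∀ e, mark (bar e) * mark e = 1
  /-- vertex compatibility at the trivalent vertices -/
  mark_vertex : ∀ e, e ≠ bar tail → mark e * mark (rot e) * mark (rot (rot e)) = 1
  /-- full rank -/
  mark_full : Subgroup.closure (Set.range mark) = ⊤
  /-- geometricity -/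
  mark_tail : mark (bar tail) = boundaryWord g

namespace MarkedFatgraph

variable {g : ℕ}

/-- The fatgraph `φ(G)`: the same fatgraph, with marking post-composed with `φ`. -/
def act (φ : mappingClassGroup g) (G : MarkedFatgraph g) : MarkedFatgraph g :=
  { G with
    mark := fun e => φ.1 (G.mark e)
    mark_bar := fun e => by rw [← map_mul, G.mark_bar, map_one]
    mark_vertex := fun e he => by rw [← map_mul, ← map_mul, G.mark_vertex e he, map_one]
    mark_full := by
      have h : Set.range (fun e => φ.1 (G.mark e)) =
          (φ.1 : SurfaceGroup g →* SurfaceGroup g) '' Set.range G.mark := by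
        rw [← Set.range_comp]; rfl
      rw [h, ← MonoidHom.map_closure, G.mark_full]
      exact Subgroup.map_top_of_surjective _ φ.1.surjective
    mark_tail := by
      rw [G.mark_tail]
      exact φ.2 }

/-- Isomorphism of marked fatgraphs. -/
def Iso (G G' : MarkedFatgraph g) : Prop :=
  ∃ ψ : G.Dart ≃ G'.Dart,
    (∀ x, ψ (G.bar x) = G'.bar (ψ x)) ∧
    (∀ x, ψ (G.rot x) = G'.rot (ψ x)) ∧
    (∀ x, G'.mark (ψ x) = G.mark x)

/-- `G → G'` is a marked Whitehead move along the non-tail edge `e` of `G`, which has distinct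
endpoints. With the vertices of `e` and `ē` having cyclic orders `(e, a, b)` and `(ē, c, d)`,
collapsing `e` creates a four-valent vertex with cyclic order `(a, b, c, d)`. It is expanded in
the other way, into vertices `(f, b, c)` and `(f̄, d, a)`; the rest of the fatgraph and the
markings of all oriented edges other than `e`, `ē` stay the same. The bijection `ψ` matches the
oriented edges of `G` with those of `G'`, with `e` corresponding to `f`. -/
def IsWhiteheadMove (G G' : MarkedFatgraph g) : Prop :=
  ∃ (e a b c d : G.Dart) (ψ : G.Dart ≃ G'.Dart),
    e ≠ G.tail ∧ e ≠ G.bar G.tail ∧ ¬ G.rot.SameCycle e (G.bar e) ∧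
    (G.rot e = a ∧ G.rot a = b ∧ G.rot b = e) ∧
    (G.rot (G.bar e) = c ∧ G.rot c = d ∧ G.rot d = G.bar e) ∧
    (∀ x, ψ (G.bar x) = G'.bar (ψ x)) ∧
    (G'.rot (ψ e) = ψ b ∧ G'.rot (ψ b) = ψ c ∧ G'.rot (ψ c) = ψ e) ∧
    (G'.rot (ψ (G.bar e)) = ψ d ∧ G'.rot (ψ d) = ψ a ∧ G'.rot (ψ a) = ψ (G.bar e)) ∧
    (∀ x, ¬ G.rot.SameCycle e x → ¬ G.rot.SameCycle (G.bar e) x →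
      G'.rot (ψ x) = ψ (G.rot x)) ∧
    (∀ x, x ≠ e → x ≠ G.bar e → G'.mark (ψ x) = G.mark x)

/-- The `j`-th oriented edge of the boundary cycle, starting with the tail as the `0`-th one. -/
def boundaryEdge (G : MarkedFatgraph g) (j : ℕ) : G.Dart :=
  ((G.rot.trans G.bar) ^ j) G.tail

/-- The position of an oriented edge in the boundary cycle, starting at the tail. -/
def position (G : MarkedFatgraph g) (x : G.Dart) : ℕ :=
  sInf {j : ℕ | G.boundaryEdge j = x}

/-- The sum of `F fᵢ₋₁ fᵢ` over the edge-path `x = f₀, f₁, …, fₖ = x̄` of the boundary cycle, for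
`x` preceding `x̄` when the cycle starts at the tail (so that the path does not pass
through the univalent vertex). -/
def pathSum (G : MarkedFatgraph g) (F : G.Dart → G.Dart → Tensors g) (x : G.Dart) : Tensors g :=
  ∑ j ∈ Finset.Ico (G.position x) (G.position (G.bar x)),
    F (G.boundaryEdge j) (G.boundaryEdge (j + 1))

/-- The component `ℓ_n(x)`, of degree `n`, of the logarithm of the fatgraph Magnus expansion:
`ℓ₀ = 0`, `ℓ₁(x)` is the homology class of `x`, and for `n ≥ 2`
`ℓ_n(x) = -(1/3) ∑ᵢ h(ℓ(fᵢ₋₁), -ℓ(fᵢ))_(n)` if the edge-path `(fᵢ)` from `x` to `x̄` along the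
boundary cycle avoids the univalent vertex of the tail, and `ℓ_n(x) = -ℓ_n(x̄)` otherwise.
The degree `n` component of `h` involves only components of `ℓ` of degree `< n`. -/
def ellComp (G : MarkedFatgraph g) (n : ℕ) (x : G.Dart) : Tensors g :=
  if n = 0 then 0
  else if n = 1 then TensorAlgebra.ι ℚ (homologyClass (G.mark x))
  else
    let lower : G.Dart → TensorSeries g := fun f =>
      PowerSeries.mk fun k => if _ : k < n then ellComp G k f else 0
    let S : G.Dart → Tensors g := fun y =>
      (-(1 / 3) : ℚ) • G.pathSum
        (fun f f' => PowerSeries.coeff n (hausdorff (lower f) (-lower f'))) y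
    if G.position x < G.position (G.bar x) then S x else -S (G.bar x)
termination_by n

/-- `ℓ(x) = ∑ₙ ℓ_n(x)`. -/
def ell (G : MarkedFatgraph g) (x : G.Dart) : TensorSeries g :=
  PowerSeries.mk fun n => G.ellComp n x

/-- `θ` is the fatgraph Magnus expansion of `G`: the generalized Magnus expansion with
`θ(x) = exp(ℓ(x))` for (the elements of `π₁` that mark) the oriented edges `x` of `G`. -/
def IsFatgraphMagnus (G : MarkedFatgraph g) (θ : SurfaceGroup g →* TensorSeries g) : Prop :=
  IsMagnusExpansion θ ∧ ∀ x : G.Dart, θ (G.mark x) = expSeries (G.ell x)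

/-- The fatgraph Magnus expansion `θ^G`, that is, the unique `θ` with `IsFatgraphMagnus G θ`. -/
def magnus (G : MarkedFatgraph g) : SurfaceGroup g →* TensorSeries g :=
  Classical.epsilon G.IsFatgraphMagnus

/-- The component `θ^G_n : π₁ → H^{⊗ n}` of degree `n`. -/
def magnusComp (G : MarkedFatgraph g) (n : ℕ) (x : SurfaceGroup g) : Tensors g :=
  PowerSeries.coeff n (G.magnus x)

end MarkedFatgraph

end FatgraphJohnson

end

/-! The sum telescopes to `θ^G - θ^{φ(G)}` in degree `m+1`. If `θ` is any Magnus expansion and `φ`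
acts trivially on `π₁/Γ_m`, then `θ(φ(y)y⁻¹)` is `1` plus terms of degree at least `m+1`, and its
leading term is `τ_m(φ)[y]`. Hence `τ_m(φ)[y] = θ_{m+1}(φ(y)) - θ_{m+1}(y)`
(`IsJohnson.apply_homologyClass`). The recursion for `ℓ` uses only the combinatorics of the fatgraph
and the homology classes of the marking, and these classes are fixed by `φ` since `m ≥ 1`. So
`θ^{φ(G)}(φ(y)) = θ^G(y)` (`magnus_apply_of_iso_act`). Taking `θ = θ^G` and `x = φ(y)`, so that `[x]
= [y]`, gives the formula.

Most of the work is the existence of `θ^G`, which needs two facts.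

First, `exp ℓ` satisfies the vertex relations (`expSeries_vertex`). In degree `n`, `ℓ_n` is one
third of a difference of partial sums of corner terms along the boundary cycle. The three edges at a
trivalent vertex leave minus one third of the three corner terms there. The relation in lower
degrees makes these terms equal, and their common value is exactly the defect in degree `n`.

Second, the relations of a marking suffice to define a homomorphism to unipotent series on `π₁`. No
presentation of `π₁` is constructed. An Euler characteristic count bounds the rational solutions of
the linearized relations by dimension `2g`, so all of them come from characters of `π₁`
(`exists_character`). Two homomorphisms on the free group on the oriented edges are then compared
degree by degree: their first difference is additive, hence controlled by characters
(`hom_eq_of_eq_on_generators`). -/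

noncomputable section

namespace FatgraphJohnson

/-! ### Noncommutative power series: congruence modulo powers of `X`, exponential and logarithm. -/

section Series

variable {A : Type*} [Ring A]

/-- Equality of power series modulo `Xⁿ`. -/
def EqUpTo (n : ℕ) (f g : PowerSeries A) : Prop :=
  ∀ j < n, PowerSeries.coeff j f = PowerSeries.coeff j g

namespace EqUpTo

variable {n : ℕ} {f g f' g' h : PowerSeries A}

theorem refl (n : ℕ) (f : PowerSeries A) : EqUpTo n f f := fun _ _ => rfl

theorem symm (h : EqUpTo n f g) : EqUpTo n g f := fun j hj => (h j hj).symm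

theorem trans (h₁ : EqUpTo n f g) (h₂ : EqUpTo n g h) : EqUpTo n f h :=
  fun j hj => (h₁ j hj).trans (h₂ j hj)

theorem mono {m : ℕ} (hmn : m ≤ n) (h : EqUpTo n f g) : EqUpTo m f g :=
  fun j hj => h j (hj.trans_le hmn)

theorem add (h₁ : EqUpTo n f g) (h₂ : EqUpTo n f' g') : EqUpTo n (f + f') (g + g') :=
  fun j hj => by rw [map_add, map_add, h₁ j hj, h₂ j hj]

theorem sub (h₁ : EqUpTo n f g) (h₂ : EqUpTo n f' g') : EqUpTo n (f - f') (g - g') :=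
  fun j hj => by rw [map_sub, map_sub, h₁ j hj, h₂ j hj]

theorem mul (h₁ : EqUpTo n f g) (h₂ : EqUpTo n f' g') : EqUpTo n (f * f') (g * g') := by
  intro j hj
  rw [PowerSeries.coeff_mul, PowerSeries.coeff_mul]
  refine Finset.sum_congr rfl fun p hp => ?_
  have := Finset.HasAntidiagonal.mem_antidiagonal.1 hp
  rw [h₁ p.1 (by omega), h₂ p.2 (by omega)]

theorem pow (h₁ : EqUpTo n f g) (k : ℕ) : EqUpTo n (f ^ k) (g ^ k) := by
  induction k with
  | zero => simpa using refl n 1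
  | succ k ih => simpa only [pow_succ] using ih.mul h₁

/-- In the first degree in which `f`, `g` and `f'`, `g'` differ, the differences add up in
products of series with constant term `1`. -/
theorem coeff_mul_sub (h₁ : EqUpTo n f g) (h₂ : EqUpTo n f' g')
    (hf' : PowerSeries.coeff 0 f' = 1) (hg : PowerSeries.coeff 0 g = 1) :
    PowerSeries.coeff n (f * f') - PowerSeries.coeff n (g * g') =
      (PowerSeries.coeff n f - PowerSeries.coeff n g) +
        (PowerSeries.coeff n f' - PowerSeries.coeff n g') := by
  have e : f * f' - g * g' = (f - g) * f' + g * (f' - g') := by noncomm_ring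
  have h1 : PowerSeries.coeff n ((f - g) * f') = PowerSeries.coeff n (f - g) := by
    rw [PowerSeries.coeff_mul, Finset.sum_eq_single (n, 0)]
    · rw [hf', mul_one]
    · rintro ⟨a, b⟩ hab hne
      have hab := Finset.HasAntidiagonal.mem_antidiagonal.1 hab
      have : a < n := by
        rcases Nat.eq_zero_or_pos b with rfl | hb
        · exact absurd (by simpa using hab) (fun h => hne (by simp [h]))
        · simp only at hab; omega
      rw [map_sub, h₁ a this, sub_self, zero_mul]
    · simp
  have h2 : PowerSeries.coeff n (g * (f' - g')) = PowerSeries.coeff n (f' - g') := by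
    rw [PowerSeries.coeff_mul, Finset.sum_eq_single (0, n)]
    · rw [hg, one_mul]
    · rintro ⟨a, b⟩ hab hne
      have hab := Finset.HasAntidiagonal.mem_antidiagonal.1 hab
      have : b < n := by
        rcases Nat.eq_zero_or_pos a with rfl | hb
        · exact absurd (by simpa using hab) (fun h => hne (by simp [h]))
        · simp only at hab; omega
      rw [map_sub, h₂ b this, sub_self, mul_zero]
    · simp
  rw [← map_sub, e, map_add, h1, h2, map_sub, map_sub]

end EqUpTo

theorem coeff_zero_mul_series (f g : PowerSeries A) :
    PowerSeries.coeff 0 (f * g) = PowerSeries.coeff 0 f * PowerSeries.coeff 0 g := by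
  simp [PowerSeries.coeff_mul]

theorem coeff_pow_eq_zero {f : PowerSeries A} (hf : PowerSeries.coeff 0 f = 0) {n k : ℕ}
    (h : n < k) : PowerSeries.coeff n (f ^ k) = 0 := by
  induction k generalizing n with
  | zero => omega
  | succ k ih =>
    rw [pow_succ, PowerSeries.coeff_mul]
    refine Finset.sum_eq_zero fun p hp => ?_
    have hp := Finset.HasAntidiagonal.mem_antidiagonal.1 hp
    rcases Nat.eq_zero_or_pos p.2 with h0 | h0
    · rw [h0, hf, mul_zero]
    · rw [ih (by omega), zero_mul]

variable [Algebra ℚ A]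

/-- The value `∑ₖ pₖ uᵏ` of the power series `p` at a power series `u` without constant term. -/
def evalSeries (u : PowerSeries A) (p : PowerSeries ℚ) : PowerSeries A :=
  PowerSeries.mk fun n =>
    ∑ k ∈ Finset.range (n + 1), PowerSeries.coeff k p • PowerSeries.coeff n (u ^ k)

section evalSeries

variable {u : PowerSeries A}

theorem coeff_aeval (hu : PowerSeries.coeff 0 u = 0) (P : Polynomial ℚ) (n : ℕ) :
    PowerSeries.coeff n (Polynomial.aeval u P) =
      ∑ k ∈ Finset.range (n + 1), P.coeff k • PowerSeries.coeff n (u ^ k) := by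
  rw [Polynomial.aeval_eq_sum_range' (n := max (P.natDegree + 1) (n + 1)) (by simp), map_sum]
  have h : ∀ k, PowerSeries.coeff n (P.coeff k • u ^ k) =
      P.coeff k • PowerSeries.coeff n (u ^ k) := fun k => rfl
  simp only [h]
  symm
  refine Finset.sum_subset (by intro k; simp; omega) fun k _ hk => ?_
  rw [coeff_pow_eq_zero hu (by simpa using hk), smul_zero]

/-- Each coefficient sees only finitely many powers of `u`, so `p` may be truncated to a polynomial,
where evaluation is a ring homomorphism. Multiplicativity of `evalSeries` follows, although `A` is
not commutative. -/
theorem coeff_evalSeries (hu : PowerSeries.coeff 0 u = 0) (p : PowerSeries ℚ) {n N : ℕ}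
    (h : n < N) : PowerSeries.coeff n (evalSeries u p) =
      PowerSeries.coeff n (Polynomial.aeval u (PowerSeries.trunc N p)) := by
  rw [coeff_aeval hu, evalSeries, PowerSeries.coeff_mk]
  refine Finset.sum_congr rfl fun k hk => ?_
  have := Finset.mem_range.1 hk
  rw [PowerSeries.coeff_trunc, if_pos (by omega)]

theorem evalSeries_mul (hu : PowerSeries.coeff 0 u = 0) (p q : PowerSeries ℚ) :
    evalSeries u (p * q) = evalSeries u p * evalSeries u q := by
  ext n
  have h : EqUpTo (n + 1) (evalSeries u p * evalSeries u q)
      (Polynomial.aeval u (PowerSeries.trunc (n + 1) p) *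
        Polynomial.aeval u (PowerSeries.trunc (n + 1) q)) :=
    EqUpTo.mul (fun j hj => coeff_evalSeries hu p hj) (fun j hj => coeff_evalSeries hu q hj)
  rw [h n (by omega), ← map_mul, coeff_aeval hu, evalSeries, PowerSeries.coeff_mk]
  refine Finset.sum_congr rfl fun k hk => ?_
  have hk := Finset.mem_range.1 hk
  congr 1
  rw [Polynomial.coeff_mul, PowerSeries.coeff_mul]
  refine Finset.sum_congr rfl fun a ha => ?_
  have ha := Finset.HasAntidiagonal.mem_antidiagonal.1 ha
  rw [PowerSeries.coeff_trunc, PowerSeries.coeff_trunc, if_pos (by omega), if_pos (by omega)]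

theorem evalSeries_one : evalSeries u 1 = 1 := by
  ext n
  rw [evalSeries, PowerSeries.coeff_mk, Finset.sum_range_succ', Finset.sum_eq_zero]
  · simp
  · intro k _
    simp [PowerSeries.coeff_one]

theorem evalSeries_pow (hu : PowerSeries.coeff 0 u = 0) (p : PowerSeries ℚ) (k : ℕ) :
    evalSeries u (p ^ k) = evalSeries u p ^ k := by
  induction k with
  | zero => simp [evalSeries_one]
  | succ k ih => rw [pow_succ, pow_succ, evalSeries_mul hu, ih]

theorem evalSeries_X (hu : PowerSeries.coeff 0 u = 0) : evalSeries u PowerSeries.X = u := by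
  ext n
  rw [evalSeries, PowerSeries.coeff_mk]
  rcases Nat.eq_zero_or_pos n with rfl | hn
  · simp [hu]
  · rw [Finset.sum_eq_single 1] <;> simp +contextual [PowerSeries.coeff_X]
    omega

theorem evalSeries_add (p q : PowerSeries ℚ) :
    evalSeries u (p + q) = evalSeries u p + evalSeries u q := by
  ext n
  simp [evalSeries, add_smul, Finset.sum_add_distrib]

theorem evalSeries_neg (p : PowerSeries ℚ) : evalSeries u (-p) = -evalSeries u p := by
  ext n
  simp [evalSeries]

/-- Interchange the two finite sums; the ranges match because `p ^ i` has no coefficient below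
degree `i`. Identities between `exp` and `log` thus need checking only in one variable over `ℚ`. -/
theorem expSeries_evalSeries (hu : PowerSeries.coeff 0 u = 0) {p : PowerSeries ℚ}
    (hp : PowerSeries.coeff 0 p = 0) :
    expSeries (evalSeries u p) = evalSeries u (expSeries p) := by
  ext n
  simp only [expSeries, PowerSeries.coeff_mk, ← evalSeries_pow hu]
  simp only [evalSeries, PowerSeries.coeff_mk, Finset.smul_sum]
  rw [Finset.sum_comm]
  refine Finset.sum_congr rfl fun k hk => ?_
  have hk := Finset.mem_range.1 hk
  rw [Finset.sum_smul]
  symm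
  rw [← Finset.sum_subset (s₁ := Finset.range (k + 1)) (s₂ := Finset.range (n + 1))
    (f := fun i => ((i.factorial : ℚ)⁻¹) • PowerSeries.coeff k (p ^ i) • PowerSeries.coeff n (u ^ k))]
  · exact Finset.sum_congr rfl fun i _ => smul_assoc _ _ _
  · intro i; simp; omega
  · intro i _ hi
    rw [coeff_pow_eq_zero hp (by simpa using hi), zero_smul, smul_zero]

theorem logSeries_eq_evalSeries (f : PowerSeries A) :
    logSeries f = evalSeries (f - 1) (PowerSeries.log ℚ) := by
  ext n
  rw [logSeries, evalSeries, PowerSeries.coeff_mk, PowerSeries.coeff_mk,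
    Finset.sum_range_succ', Finset.range_eq_Ico, Finset.sum_Ico_add' (c := 1)
      (f := fun k => PowerSeries.coeff k (PowerSeries.log ℚ) • PowerSeries.coeff n ((f - 1) ^ k))]
  have h0 : PowerSeries.coeff 0 (PowerSeries.log ℚ) = 0 := by simp
  rw [h0, zero_smul, add_zero]
  refine Finset.sum_congr rfl fun k hk => ?_
  have hk : k ≠ 0 := by have := (Finset.mem_Ico.1 hk).1; omega
  rw [PowerSeries.coeff_log, if_neg hk]
  rfl

end evalSeries

theorem expSeries_eq_subst {p : PowerSeries ℚ} (hp : PowerSeries.coeff 0 p = 0) :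
    expSeries p = (PowerSeries.exp ℚ).subst p := by
  have hs : PowerSeries.HasSubst p := PowerSeries.HasSubst.of_constantCoeff_zero' (by simpa using hp)
  ext n
  rw [PowerSeries.coeff_subst' hs, expSeries, PowerSeries.coeff_mk,
    finsum_eq_sum_of_support_subset (s := Finset.range (n + 1))]
  · simp [PowerSeries.coeff_exp]
  · intro k hk
    by_contra h
    exact hk (by simp only [coeff_pow_eq_zero hp (by simpa using h), smul_zero])

/-- The series `F = exp(log(1 + X))` solves `F' (1 + X) = F` with `F(0) = 1`, and this determines
all its coefficients. -/
theorem expSeries_log : expSeries (PowerSeries.log ℚ) = 1 + PowerSeries.X := by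
  have hs := PowerSeries.HasSubst.log (A := ℚ)
  have h0 : PowerSeries.coeff 0 (expSeries (PowerSeries.log ℚ)) = 1 := by simp [expSeries]
  have hgeom : PowerSeries.derivative ℚ (PowerSeries.log ℚ) * (1 + PowerSeries.X) = 1 := by
    rw [PowerSeries.deriv_log]
    ext n
    rcases n with _ | n
    · simp [mul_add]
    · simp [mul_add, PowerSeries.coeff_succ_mul_X, PowerSeries.coeff_one, pow_succ]
  have hd : PowerSeries.derivative ℚ (expSeries (PowerSeries.log ℚ)) * (1 + PowerSeries.X) =
      expSeries (PowerSeries.log ℚ) := by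
    rw [expSeries_eq_subst (by simp), PowerSeries.derivative_subst hs, PowerSeries.derivative_exp,
      mul_assoc, hgeom, mul_one]
  generalize expSeries (PowerSeries.log ℚ) = F at h0 hd
  have h1 : PowerSeries.coeff 1 F = 1 := by
    have := congrArg (PowerSeries.coeff 0) hd
    have hc := PowerSeries.coeff_derivative F 0
    simp only [mul_add, mul_one, map_add, PowerSeries.coeff_zero_mul_X, add_zero] at this
    simpa [this, h0] using hc.symm
  have hrec : ∀ n : ℕ, PowerSeries.coeff (n + 2) F * (n + 2) = - (n * PowerSeries.coeff (n + 1) F) := by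
    intro n
    have := congrArg (PowerSeries.coeff (n + 1)) hd
    simp [mul_add, PowerSeries.coeff_derivative, PowerSeries.coeff_succ_mul_X] at this
    linear_combination this
  -- For `n = 0` the right side of the recursion has the factor `0`, which kills the coefficient of
  -- degree `2` and then all later ones.
  have h2 : ∀ n : ℕ, PowerSeries.coeff (n + 2) F = 0 := by
    intro n
    have hr := hrec n
    have hn : ((n : ℚ) + 2) ≠ 0 := by positivity
    induction n with
    | zero => simpa using hr
    | succ n ih =>
      rw [ih (hrec n) (by positivity), mul_zero, neg_zero] at hr
      exact (mul_eq_zero.1 hr).resolve_right hn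
  ext n
  rcases n with _ | _ | n
  · simpa using h0
  · simp [h1, PowerSeries.coeff_one]
  · rw [h2]
    simp [PowerSeries.coeff_one, PowerSeries.coeff_X]

theorem expSeries_neg_X_mul :
    expSeries (-PowerSeries.X : PowerSeries ℚ) * expSeries PowerSeries.X = 1 := by
  have h1 : expSeries (PowerSeries.X : PowerSeries ℚ) = PowerSeries.exp ℚ := by
    ext n
    simp [expSeries, PowerSeries.coeff_X_pow, PowerSeries.coeff_exp]
  have h2 : expSeries (-PowerSeries.X : PowerSeries ℚ) =
      PowerSeries.evalNegHom (PowerSeries.exp ℚ) := by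
    ext n
    have h : ∀ k, PowerSeries.coeff n ((-PowerSeries.X : PowerSeries ℚ) ^ k) =
        if n = k then (-1) ^ n else 0 := by
      intro k
      have : ((-1 : PowerSeries ℚ) ^ k) = PowerSeries.C ((-1 : ℚ) ^ k) := by simp
      rw [neg_pow, this, PowerSeries.coeff_C_mul, PowerSeries.coeff_X_pow]
      split_ifs with h
      · rw [h, mul_one]
      · rw [mul_zero]
    simp [expSeries, h, PowerSeries.evalNegHom, PowerSeries.coeff_exp, mul_comm]
  rw [h1, h2, mul_comm, PowerSeries.exp_mul_exp_neg_eq_one]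

theorem expSeries_neg_mul {f : PowerSeries A} (hf : PowerSeries.coeff 0 f = 0) :
    expSeries (-f) * expSeries f = 1 := by
  have h := congrArg (evalSeries f) expSeries_neg_X_mul
  rwa [evalSeries_mul hf, evalSeries_one, ← expSeries_evalSeries hf (by simp),
    ← expSeries_evalSeries hf (by simp), evalSeries_neg, evalSeries_X hf] at h

theorem expSeries_logSeries {f : PowerSeries A} (hf : PowerSeries.coeff 0 f = 1) :
    expSeries (logSeries f) = f := by
  have h0 : PowerSeries.coeff 0 (f - 1) = 0 := by simpa [sub_eq_zero] using hf
  rw [logSeries_eq_evalSeries, expSeries_evalSeries h0 (by simp), expSeries_log, evalSeries_add,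
    evalSeries_one, evalSeries_X h0, add_sub_cancel]

theorem coeff_zero_expSeries (f : PowerSeries A) : PowerSeries.coeff 0 (expSeries f) = 1 := by
  simp [expSeries]

theorem coeff_one_expSeries (f : PowerSeries A) :
    PowerSeries.coeff 1 (expSeries f) = PowerSeries.coeff 1 f := by
  simp [expSeries, Finset.sum_range_succ, PowerSeries.coeff_one]

theorem coeff_zero_logSeries (f : PowerSeries A) : PowerSeries.coeff 0 (logSeries f) = 0 := by
  simp [logSeries]

theorem EqUpTo.expSeries {n : ℕ} {f g : PowerSeries A} (h : EqUpTo n f g) :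
    EqUpTo n (expSeries f) (expSeries g) := fun j hj => by
  simp only [FatgraphJohnson.expSeries, PowerSeries.coeff_mk]
  exact Finset.sum_congr rfl fun k _ => by rw [h.pow k j hj]

theorem EqUpTo.logSeries {n : ℕ} {f g : PowerSeries A} (h : EqUpTo n f g) :
    EqUpTo n (logSeries f) (logSeries g) := fun j hj => by
  simp only [FatgraphJohnson.logSeries, PowerSeries.coeff_mk]
  exact Finset.sum_congr rfl fun k _ => by rw [(h.sub (.refl n 1)).pow k j hj]

/-- In the first degree `n` in which `f` and `g` differ, their exponentials differ by the same
amount. -/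
theorem EqUpTo.coeff_expSeries_sub {n : ℕ} (hn : n ≠ 0) {f g : PowerSeries A} (h : EqUpTo n f g)
    (hf : PowerSeries.coeff 0 f = 0) (hg : PowerSeries.coeff 0 g = 0) :
    PowerSeries.coeff n (FatgraphJohnson.expSeries f) -
      PowerSeries.coeff n (FatgraphJohnson.expSeries g) =
      PowerSeries.coeff n f - PowerSeries.coeff n g := by
  simp only [FatgraphJohnson.expSeries, PowerSeries.coeff_mk, ← Finset.sum_sub_distrib, ← smul_sub]
  rw [Finset.sum_eq_single 1]
  · simp
  · intro k _ hk
    rcases k with _ | _ | k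
    · simp
    · exact absurd rfl hk
    -- With at least two factors and no constant terms, the coefficient of degree `n` involves only
    -- coefficients of degree less than `n`, where `f` and `g` agree.
    have key : PowerSeries.coeff n (f ^ (k + 2)) = PowerSeries.coeff n (g ^ (k + 2)) := by
      rw [pow_succ f, pow_succ g, PowerSeries.coeff_mul, PowerSeries.coeff_mul]
      refine Finset.sum_congr rfl fun p hp => ?_
      have hp := Finset.HasAntidiagonal.mem_antidiagonal.1 hp
      rcases Nat.eq_zero_or_pos p.1 with h1 | h1
      · rw [h1, coeff_pow_eq_zero hf (by omega), coeff_pow_eq_zero hg (by omega), zero_mul, zero_mul]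
      rcases Nat.eq_zero_or_pos p.2 with h2 | h2
      · rw [h2, hf, hg, mul_zero, mul_zero]
      rw [h.pow _ p.1 (by omega), h p.2 (by omega)]
    rw [key, sub_self, smul_zero]
  · intro h1
    simp at h1
    exact absurd h1 hn

end Series

/-! ### Leading terms of products. -/

section LeadingTerms

variable {A : Type*} [Ring A]

theorem EqUpTo.mul_zero_series {p q : ℕ} {f h : PowerSeries A} (hf : EqUpTo p f 0)
    (hh : EqUpTo q h 0) : EqUpTo (p + q) (f * h) 0 := by
  intro j hj
  rw [PowerSeries.coeff_mul, map_zero]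
  refine Finset.sum_eq_zero fun a ha => ?_
  have ha := Finset.HasAntidiagonal.mem_antidiagonal.1 ha
  rcases lt_or_ge a.1 p with h1 | h1
  · rw [hf _ h1, map_zero, zero_mul]
  · rw [hh a.2 (by omega), map_zero, mul_zero]

theorem EqUpTo.coeff_mul_leading {p q : ℕ} {f h : PowerSeries A} (hf : EqUpTo p f 0)
    (hh : EqUpTo q h 0) : PowerSeries.coeff (p + q) (f * h) =
      PowerSeries.coeff p f * PowerSeries.coeff q h := by
  rw [PowerSeries.coeff_mul, Finset.sum_eq_single (p, q)]
  · rintro ⟨a, b⟩ ha hne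
    have ha : a + b = p + q := Finset.HasAntidiagonal.mem_antidiagonal.1 ha
    rcases lt_trichotomy a p with h1 | h1 | h1
    · rw [hf _ h1, map_zero, zero_mul]
    · exact absurd (by rw [Prod.mk.injEq]; omega) hne
    · rw [hh b (by omega), map_zero, mul_zero]
  · simp

end LeadingTerms

/-! ### Rational homology of the surface group and its universal property. -/

variable {g : ℕ}

theorem homologyClass_mul (x y : SurfaceGroup g) :
    homologyClass (x * y) = homologyClass x + homologyClass y := by
  simp [homologyClass, TensorProduct.tmul_add]

theorem homologyClass_one : homologyClass (1 : SurfaceGroup g) = 0 := by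
  simp [homologyClass]

theorem homologyClass_inv (x : SurfaceGroup g) : homologyClass x⁻¹ = -homologyClass x := by
  rw [eq_neg_iff_add_eq_zero, ← homologyClass_mul, inv_mul_cancel, homologyClass_one]

/-- Rational linear maps on homology are determined by their values on homology classes. -/
theorem homology_hom_ext {V : Type*} [AddCommGroup V] [Module ℚ V] {τ τ' : Homology g →ₗ[ℚ] V}
    (h : ∀ x : SurfaceGroup g, τ (homologyClass x) = τ' (homologyClass x)) : τ = τ' := by
  refine LinearMap.ext fun z => ?_
  induction z using TensorProduct.induction_on with
  | zero => simp
  | add a b ha hb => rw [map_add, map_add, ha, hb]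
  | tmul q a =>
    obtain ⟨x, hx⟩ := QuotientGroup.mk_surjective a.toMul
    have : q ⊗ₜ[ℤ] a = q • homologyClass x := by
      have hx' : Additive.ofMul (Abelianization.of x) = a := hx
      rw [homologyClass, TensorProduct.smul_tmul', smul_eq_mul, mul_one, hx']
    rw [this, map_smul, map_smul, h]

/-- Homomorphisms from the surface group to rational vector spaces factor through homology. -/
theorem exists_homology_lift {V : Type*} [AddCommGroup V] [Module ℚ V] (D : SurfaceGroup g → V)
    (hD : ∀ x y, D (x * y) = D x + D y) :
    ∃ τ : Homology g →ₗ[ℚ] V, ∀ x, τ (homologyClass x) = D x := by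
  let F : SurfaceGroup g →* Multiplicative V :=
    MonoidHom.mk' (fun x => Multiplicative.ofAdd (D x)) fun x y => by rw [hD, ofAdd_add]
  let L : Additive (Abelianization (SurfaceGroup g)) →+ V :=
    MonoidHom.toAdditiveLeft (Abelianization.lift F)
  refine ⟨LinearMap.liftBaseChange ℚ L.toIntLinearMap, fun x => ?_⟩
  rw [homologyClass, LinearMap.liftBaseChange_tmul, one_smul]
  simp [L, F]

/-! ### Closure properties of the completed tensor algebra. -/

section Homogeneous

/-- The component `H^{⊗ n}` of the tensor algebra. -/
abbrev tensorDegree (g n : ℕ) : Submodule ℚ (Tensors g) :=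
  (LinearMap.range (TensorAlgebra.ι ℚ (M := Homology g)) : Submodule ℚ (Tensors g)) ^ n

theorem IsHomogeneous.one : IsHomogeneous (1 : TensorSeries g) := by
  intro n
  rw [PowerSeries.coeff_one]
  split_ifs with h
  · rw [h, pow_zero]
    exact Submodule.one_le.1 le_rfl
  · exact zero_mem _

theorem IsHomogeneous.sub {f h : TensorSeries g} (hf : IsHomogeneous f) (hh : IsHomogeneous h) :
    IsHomogeneous (f - h) := fun n => by
  rw [map_sub]; exact sub_mem (hf n) (hh n)

theorem IsHomogeneous.mul {f h : TensorSeries g} (hf : IsHomogeneous f) (hh : IsHomogeneous h) :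
    IsHomogeneous (f * h) := fun n => by
  rw [PowerSeries.coeff_mul]
  refine sum_mem fun p hp => ?_
  rw [← Finset.HasAntidiagonal.mem_antidiagonal.1 hp, pow_add]
  exact Submodule.mul_mem_mul (hf _) (hh _)

theorem IsHomogeneous.pow {f : TensorSeries g} (hf : IsHomogeneous f) (k : ℕ) :
    IsHomogeneous (f ^ k) := by
  induction k with
  | zero => rw [pow_zero]; exact .one
  | succ k ih => rw [pow_succ]; exact ih.mul hf

theorem IsHomogeneous.expSeries {f : TensorSeries g} (hf : IsHomogeneous f) :
    IsHomogeneous (expSeries f) := fun n => by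
  rw [FatgraphJohnson.expSeries, PowerSeries.coeff_mk]
  exact sum_mem fun k _ => Submodule.smul_mem _ _ (hf.pow k n)

theorem IsHomogeneous.logSeries {f : TensorSeries g} (hf : IsHomogeneous f) :
    IsHomogeneous (logSeries f) := fun n => by
  rw [FatgraphJohnson.logSeries, PowerSeries.coeff_mk]
  exact sum_mem fun k _ => Submodule.smul_mem _ _ ((hf.sub .one).pow k n)

theorem IsHomogeneous.hausdorff {f h : TensorSeries g} (hf : IsHomogeneous f)
    (hh : IsHomogeneous h) : IsHomogeneous (hausdorff f h) :=
  ((hf.expSeries.mul hh.expSeries).logSeries.sub hf).sub hh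

end Homogeneous

/-! ### Johnson homomorphisms computed by Magnus expansions. -/

section Johnson

variable {θ : SurfaceGroup g →* TensorSeries g}

/-- The leading term of a generalized Magnus expansion on the lower central series. -/
theorem IsLieClass.magnus (hθ : IsMagnusExpansion θ) {k : ℕ} {x : SurfaceGroup g} {u : Tensors g}
    (h : IsLieClass k x u) :
    EqUpTo (k + 1) (θ x) 1 ∧ PowerSeries.coeff (k + 1) (θ x) = u := by
  have h1 : ∀ n : ℕ, PowerSeries.coeff (n + 1) (1 : TensorSeries g) = 0 := fun n => by
    simp [PowerSeries.coeff_one]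
  have h01 : PowerSeries.coeff 0 (1 : TensorSeries g) = 1 := by simp
  induction h with
  | of x =>
    refine ⟨fun j hj => ?_, hθ.coeff_one x⟩
    obtain rfl : j = 0 := by omega
    rw [hθ.coeff_zero, h01]
  | @commutator k x u y _ ih =>
    have hx : EqUpTo (k + 1) (θ x - 1) 0 := by simpa using ih.1.sub (.refl _ 1)
    have hy : EqUpTo 1 (θ y - 1) 0 := fun j hj => by
      obtain rfl : j = 0 := by omega
      rw [map_sub, hθ.coeff_zero, h01, sub_self, map_zero]
    -- Vacuous, but it lets the leading-term lemma treat this factor as having order `0`, so that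
    -- only its constant term `1` enters.
    have hc0 : EqUpTo 0 (θ (x⁻¹ * y⁻¹)) 0 := fun j hj => absurd hj (by omega)
    have hcx : PowerSeries.coeff (k + 1) (θ x - 1) = u := by rw [map_sub, ih.2, h1, sub_zero]
    have hcy : PowerSeries.coeff 1 (θ y - 1) = TensorAlgebra.ι ℚ (homologyClass y) := by
      rw [map_sub, hθ.coeff_one, h1, sub_zero]
    -- From `xyx⁻¹y⁻¹ - 1 = (xy - yx)x⁻¹y⁻¹`: the leading term of the group commutator is the Lie
    -- bracket of the leading terms.
    have e : θ ⁅x, y⁆ = 1 + ((θ x - 1) * (θ y - 1) - (θ y - 1) * (θ x - 1)) * θ (x⁻¹ * y⁻¹) := by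
      have e1 : (θ x - 1) * (θ y - 1) - (θ y - 1) * (θ x - 1) = θ (x * y) - θ (y * x) := by
        rw [map_mul, map_mul]; noncomm_ring
      rw [e1, sub_mul, ← map_mul, ← map_mul, commutatorElement_def]
      have : y * x * (x⁻¹ * y⁻¹) = 1 := by group
      rw [this, map_one]
      simp [mul_assoc]
    have hs : EqUpTo (k + 1 + 1) ((θ x - 1) * (θ y - 1) - (θ y - 1) * (θ x - 1)) 0 := by
      have := (hx.mul_zero_series hy).sub (add_comm 1 (k + 1) ▸ hy.mul_zero_series hx)
      rwa [sub_zero] at this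
    constructor
    · rw [e]
      simpa using (EqUpTo.refl _ 1).add (hs.mul_zero_series hc0)
    · rw [e, map_add, h1, zero_add]
      have := hs.coeff_mul_leading hc0
      rw [add_zero] at this
      rw [this, hθ.coeff_zero, mul_one, map_sub, hx.coeff_mul_leading hy]
      rw [add_comm (k + 1) 1, hy.coeff_mul_leading hx, hcx, hcy, Ring.lie_def]
  | @mul k x y u v _ _ ihx ihy =>
    refine ⟨by simpa using ihx.1.mul ihy.1, ?_⟩
    have := ihx.1.coeff_mul_sub ihy.1 (hθ.coeff_zero y) h01
    rwa [mul_one, h1, sub_zero, sub_zero, sub_zero, ihx.2, ihy.2, ← map_mul] at this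
  | @inv k x u _ ih =>
    have e : θ x⁻¹ * θ x = 1 := by rw [← map_mul, inv_mul_cancel, map_one]
    have h2 : EqUpTo (k + 1) (θ x⁻¹) 1 := by
      have := (EqUpTo.refl (k + 1) (θ x⁻¹)).mul ih.1
      rw [e, mul_one] at this
      exact this.symm
    refine ⟨h2, ?_⟩
    have := h2.coeff_mul_sub ih.1 (hθ.coeff_zero x) h01
    rw [e, mul_one, sub_self, h1, sub_zero, sub_zero, ih.2] at this
    exact eq_neg_of_add_eq_zero_left this.symm

theorem exists_isLieClass {k : ℕ} {x : SurfaceGroup g}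
    (hx : x ∈ (⊤ : Subgroup (SurfaceGroup g)).lowerCentralSeries k) : ∃ u, IsLieClass k x u := by
  induction k generalizing x with
  | zero => exact ⟨_, .of x⟩
  | succ k ih =>
    rw [Subgroup.mem_lowerCentralSeries_succ_iff] at hx
    induction hx using Subgroup.closure_induction with
    | mem x hx =>
      obtain ⟨p, hp, q, _, rfl⟩ := hx
      obtain ⟨u, hu⟩ := ih hp
      exact ⟨_, .commutator q hu⟩
    | one =>
      obtain ⟨u, hu⟩ := ih (one_mem _)
      exact ⟨_, by simpa using IsLieClass.commutator 1 hu⟩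
    | mul x y _ _ hx hy =>
      obtain ⟨u, hu⟩ := hx
      obtain ⟨v, hv⟩ := hy
      exact ⟨_, .mul hu hv⟩
    | inv x _ hx =>
      obtain ⟨u, hu⟩ := hx
      exact ⟨_, .inv hu⟩

theorem mul_inv_mem_of_mem_torelli {m : ℕ} {φ : mappingClassGroup g} (hφ : φ ∈ torelli g m)
    (x : SurfaceGroup g) :
    φ.1 x * x⁻¹ ∈ (⊤ : Subgroup (SurfaceGroup g)).lowerCentralSeries m := by
  have h := QuotientGroup.eq.1 (hφ x)
  -- Equality of cosets gives `φ(x)⁻¹x ∈ Γ_m`; inverting and conjugating by `x` turns this into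
  -- `φ(x)x⁻¹`.
  have h2 := (inferInstance :
    ((⊤ : Subgroup (SurfaceGroup g)).lowerCentralSeries m).Normal).conj_mem _ (inv_mem h) x
  have e : x * ((φ.1 x)⁻¹ * x)⁻¹ * x⁻¹ = φ.1 x * x⁻¹ := by group
  rwa [e] at h2

theorem homologyClass_of_mem_torelli {m : ℕ} (hm : 1 ≤ m) {φ : mappingClassGroup g}
    (hφ : φ ∈ torelli g m) (x : SurfaceGroup g) :
    homologyClass (φ.1 x) = homologyClass x := by
  have h := Subgroup.lowerCentralSeries_antitone _ hm (mul_inv_mem_of_mem_torelli hφ x)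
  rw [Subgroup.top_lowerCentralSeries_one] at h
  have h1 : Abelianization.of (φ.1 x * x⁻¹) = 1 := (QuotientGroup.eq_one_iff _).2 h
  rw [map_mul, map_inv, mul_inv_eq_one] at h1
  rw [homologyClass, homologyClass, h1]

/-- The Johnson homomorphism in terms of an arbitrary generalized Magnus expansion. -/
theorem IsJohnson.apply_homologyClass (hθ : IsMagnusExpansion θ) {m : ℕ} {φ : mappingClassGroup g}
    {τ : Homology g →ₗ[ℚ] Tensors g} (hτ : IsJohnson m φ τ) (x : SurfaceGroup g) :
    τ (homologyClass x) =
      PowerSeries.coeff (m + 1) (θ (φ.1 x)) - PowerSeries.coeff (m + 1) (θ x) := by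
  obtain ⟨h1, h2⟩ := (hτ x).magnus hθ
  have := h1.coeff_mul_sub (EqUpTo.refl _ (θ x)) (hθ.coeff_zero x) (by simp)
  rw [← map_mul, inv_mul_cancel_right, one_mul, h2] at this
  simpa [PowerSeries.coeff_one] using this.symm

/-- As `θ ∘ φ` and `θ` agree below degree `m+1`, their difference in degree `m+1` is additive on
`π₁` and so factors through `H`. That it is the Lie class of `φ(x)x⁻¹` holds because `θ` detects Lie
classes as leading terms, which also gives uniqueness. -/
theorem existsUnique_isJohnson (hθ : IsMagnusExpansion θ) {m : ℕ} {φ : mappingClassGroup g}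
    (hφ : φ ∈ torelli g m) : ∃! τ : Homology g →ₗ[ℚ] Tensors g, IsJohnson m φ τ := by
  have hex := fun x => exists_isLieClass (mul_inv_mem_of_mem_torelli hφ x)
  have heq : ∀ x, EqUpTo (m + 1) (θ (φ.1 x)) (θ x) := fun x => by
    obtain ⟨u, hu⟩ := hex x
    have := (hu.magnus hθ).1.mul (EqUpTo.refl _ (θ x))
    rwa [← map_mul, inv_mul_cancel_right, one_mul] at this
  obtain ⟨τ, hτ⟩ := exists_homology_lift
    (fun x => PowerSeries.coeff (m + 1) (θ (φ.1 x)) - PowerSeries.coeff (m + 1) (θ x))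
    fun x y => by
      rw [map_mul, map_mul θ, map_mul θ]
      exact (heq x).coeff_mul_sub (heq y) (hθ.coeff_zero _) (hθ.coeff_zero _)
  refine ⟨τ, fun x => ?_, fun τ' hτ' => homology_hom_ext fun x => ?_⟩
  · obtain ⟨u, hu⟩ := hex x
    have h2 := hu.magnus hθ
    have := h2.1.coeff_mul_sub (EqUpTo.refl _ (θ x)) (hθ.coeff_zero x) (by simp)
    rw [← map_mul, inv_mul_cancel_right, one_mul, h2.2, PowerSeries.coeff_one,
      if_neg (Nat.succ_ne_zero m), sub_zero, sub_self, add_zero] at this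
    rw [hτ, this]
    exact hu
  · rw [hτ, hτ'.apply_homologyClass hθ]

theorem isJohnson_johnson {m : ℕ} {φ : mappingClassGroup g}
    (h : ∃ τ : Homology g →ₗ[ℚ] Tensors g, IsJohnson m φ τ) : IsJohnson m φ (johnson m φ) :=
  Classical.epsilon_spec h

end Johnson

/-! ### The triple product of exponentials in the first degree where it is nontrivial. -/

section Series

variable {A : Type*} [Ring A]

/-- The products `f * h` and `h * f` are conjugate by `f`, which has constant term `1`, and such a
conjugation does not change a leading term. Here both orders are expanded from `f * h * f`. -/
theorem coeff_mul_rotate {n : ℕ} (hn : n ≠ 0) {f h : PowerSeries A}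
    (hf : PowerSeries.coeff 0 f = 1) (H : EqUpTo n (f * h) 1) (H' : EqUpTo n (h * f) 1) :
    PowerSeries.coeff n (h * f) = PowerSeries.coeff n (f * h) := by
  have h1 := (EqUpTo.refl n f).coeff_mul_sub H' (by rw [H' 0 (by omega)]; simp) hf
  have h2 := H.coeff_mul_sub (EqUpTo.refl n f) hf (by simp)
  rw [← mul_assoc, mul_one, sub_self, zero_add, PowerSeries.coeff_one, if_neg hn, sub_zero] at h1
  rw [one_mul, sub_self, add_zero, PowerSeries.coeff_one, if_neg hn, sub_zero] at h2
  rw [← h1, ← h2]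

variable [Algebra ℚ A]

/-- The exponential is injective modulo `Xⁿ`. -/
theorem EqUpTo.of_expSeries {n : ℕ} {f h : PowerSeries A} (hf : PowerSeries.coeff 0 f = 0)
    (hh : PowerSeries.coeff 0 h = 0)
    (H : EqUpTo n (FatgraphJohnson.expSeries f) (FatgraphJohnson.expSeries h)) :
    EqUpTo n f h := by
  induction n with
  | zero => exact fun j hj => absurd hj (by omega)
  | succ n ih =>
    have hn := ih (H.mono (Nat.le_succ n))
    intro j hj
    rcases Nat.lt_succ_iff_lt_or_eq.1 hj with h1 | rfl
    · exact hn j h1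
    · rcases Nat.eq_zero_or_pos j with rfl | h0
      · rw [hf, hh]
      · have := hn.coeff_expSeries_sub h0.ne' hf hh
        rwa [H j hj, sub_self, eq_comm, sub_eq_zero] at this

/-- If `exp X * exp Y * exp Z = 1` up to degree `n`, where `X`, `Y`, `Z` have no terms of degree
`n`, then the component of degree `n` of `exp X * exp Y * exp Z` is that of `h(X, Y)`. -/
theorem coeff_mul_exp_eq_hausdorff {n : ℕ} (hn : n ≠ 0) {X Y Z : PowerSeries A}
    (hZ : PowerSeries.coeff 0 Z = 0)
    (hXn : PowerSeries.coeff n X = 0) (hYn : PowerSeries.coeff n Y = 0)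
    (hZn : PowerSeries.coeff n Z = 0)
    (H : EqUpTo n (expSeries X * expSeries Y * expSeries Z) 1) :
    PowerSeries.coeff n (expSeries X * expSeries Y * expSeries Z) =
      PowerSeries.coeff n (hausdorff X Y) := by
  have hc : PowerSeries.coeff 0 (expSeries X * expSeries Y) = 1 := by
    rw [coeff_zero_mul_series, coeff_zero_expSeries, coeff_zero_expSeries, one_mul]
  have hQ : expSeries (logSeries (expSeries X * expSeries Y)) = expSeries X * expSeries Y :=
    expSeries_logSeries hc
  have hQ0 := coeff_zero_logSeries (expSeries X * expSeries Y)
  have hD : PowerSeries.coeff n (hausdorff X Y) =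
      PowerSeries.coeff n (logSeries (expSeries X * expSeries Y)) := by
    rw [hausdorff, map_sub, map_sub, hXn, hYn, sub_zero, sub_zero]
  rw [hD]
  generalize logSeries (expSeries X * expSeries Y) = Q at hQ hQ0
  have hZ' : PowerSeries.coeff 0 (-Z) = 0 := by rw [map_neg, hZ, neg_zero]
  have hinv : expSeries Z * expSeries (-Z) = 1 := by
    have := expSeries_neg_mul hZ'
    rwa [neg_neg] at this
  rw [← hQ] at H ⊢
  -- With `exp Q = exp X * exp Y`, the hypothesis says `Q = -Z` below degree `n`. As `Z` has no term
  -- of degree `n`, the defect of `exp Q * exp Z` there is the component of `Q`.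
  have h1 : EqUpTo n (expSeries Q) (expSeries (-Z)) := by
    have := H.mul (.refl n (expSeries (-Z)))
    rwa [mul_assoc, hinv, mul_one, one_mul] at this
  have h2 := (EqUpTo.of_expSeries hQ0 hZ' h1).coeff_expSeries_sub hn hQ0 hZ'
  have h3 := h1.coeff_mul_sub (.refl n (expSeries Z)) (coeff_zero_expSeries _)
    (coeff_zero_expSeries _)
  rw [expSeries_neg_mul hZ, PowerSeries.coeff_one, if_neg hn, sub_zero, sub_self, add_zero, h2,
    map_neg, hZn, neg_zero, sub_zero] at h3
  exact h3

theorem expSeries_zero : expSeries (0 : PowerSeries A) = 1 := by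
  ext n
  rw [expSeries, PowerSeries.coeff_mk, Finset.sum_range_succ', Finset.sum_eq_zero] <;> simp

end Series

/-! ### The boundary cycle, the recursion for `ℓ`, and the vertex relations. -/

namespace MarkedFatgraph

variable {g : ℕ} (G : MarkedFatgraph g)

theorem rot_bar_tail : G.rot (G.bar G.tail) = G.bar G.tail :=
  (G.univalent_iff _).2 rfl

theorem rot_ne_bar_tail {e : G.Dart} (he : e ≠ G.bar G.tail) : G.rot e ≠ G.bar G.tail :=
  fun h => he (G.rot.injective (h.trans G.rot_bar_tail.symm))

theorem boundaryEdge_succ (j : ℕ) :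
    G.boundaryEdge (j + 1) = G.bar (G.rot (G.boundaryEdge j)) := by
  rw [boundaryEdge, pow_succ']
  rfl

theorem boundaryEdge_position (x : G.Dart) : G.boundaryEdge (G.position x) = x :=
  Nat.sInf_mem (s := {j : ℕ | G.boundaryEdge j = x}) (G.one_boundary x)

theorem position_le {x : G.Dart} {j : ℕ} (h : G.boundaryEdge j = x) : G.position x ≤ j :=
  Nat.sInf_le h

theorem position_bar_ne (x : G.Dart) : G.position (G.bar x) ≠ G.position x := fun h =>
  G.bar_ne x (by rw [← G.boundaryEdge_position (G.bar x), h, G.boundaryEdge_position])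

/-- The boundary cycle steps from `e` to `bar (rot e)`. Only after `bar tail` does it return to the
tail, at position `0`. -/
theorem position_bar_rot {e : G.Dart} (he : e ≠ G.bar G.tail) :
    G.position (G.bar (G.rot e)) = G.position e + 1 := by
  refine le_antisymm (G.position_le ?_) ?_
  · rw [boundaryEdge_succ, boundaryEdge_position]
  · have h := G.boundaryEdge_position (G.bar (G.rot e))
    rcases hq : G.position (G.bar (G.rot e)) with _ | q
    · rw [hq] at h
      refine absurd ?_ (G.rot_ne_bar_tail he)
      have : G.tail = G.bar (G.rot e) := h
      rw [this, G.bar_bar]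
    · rw [hq, boundaryEdge_succ] at h
      exact Nat.succ_le_succ (G.position_le (G.rot.injective (G.bar.injective h)))

/-- `ℓ(x)` truncated to degrees less than `n`. -/
def ellLower (n : ℕ) (x : G.Dart) : TensorSeries g :=
  PowerSeries.mk fun k => if k < n then G.ellComp k x else 0

theorem ellComp_zero (x : G.Dart) : G.ellComp 0 x = 0 := by
  rw [ellComp, if_pos rfl]

theorem ellComp_one (x : G.Dart) :
    G.ellComp 1 x = TensorAlgebra.ι ℚ (homologyClass (G.mark x)) := by
  rw [ellComp, if_neg one_ne_zero, if_pos rfl]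

theorem ellComp_of_two_le {n : ℕ} (hn : 2 ≤ n) (x : G.Dart) :
    G.ellComp n x =
      if G.position x < G.position (G.bar x) then
        (-(1 / 3) : ℚ) • G.pathSum (fun f f' =>
          PowerSeries.coeff n (hausdorff (G.ellLower n f) (-G.ellLower n f'))) x
      else -((-(1 / 3) : ℚ) • G.pathSum (fun f f' =>
          PowerSeries.coeff n (hausdorff (G.ellLower n f) (-G.ellLower n f'))) (G.bar x)) := by
  rw [ellComp, if_neg (by omega), if_neg (by omega)]
  rfl

theorem mark_bar_eq_inv (x : G.Dart) : G.mark (G.bar x) = (G.mark x)⁻¹ :=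
  eq_inv_of_mul_eq_one_left (G.mark_bar x)

theorem ellComp_bar (n : ℕ) (x : G.Dart) : G.ellComp n (G.bar x) = -G.ellComp n x := by
  rcases n with _ | _ | n
  · rw [ellComp_zero, ellComp_zero, neg_zero]
  · rw [zero_add, ellComp_one, ellComp_one, mark_bar_eq_inv, homologyClass_inv, map_neg]
  · rw [ellComp_of_two_le G (by omega), ellComp_of_two_le G (by omega), G.bar_bar]
    have := G.position_bar_ne x
    rcases lt_or_gt_of_ne this with h | h
    · rw [if_pos h, if_neg h.not_gt, neg_neg]
    · rw [if_neg h.not_gt, if_pos h]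

theorem ellLower_bar (n : ℕ) (x : G.Dart) : G.ellLower n (G.bar x) = -G.ellLower n x := by
  ext k
  rw [map_neg, ellLower, ellLower, PowerSeries.coeff_mk, PowerSeries.coeff_mk]
  split_ifs
  · exact G.ellComp_bar k x
  · rw [neg_zero]

theorem ell_bar (x : G.Dart) : G.ell (G.bar x) = -G.ell x := by
  ext k
  rw [map_neg, ell, ell, PowerSeries.coeff_mk, PowerSeries.coeff_mk, ellComp_bar]

/-- The corner term: the component of degree `n` of `h(ℓ(x), ℓ(rot x))`. -/
def corner (n : ℕ) (x : G.Dart) : Tensors g :=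
  PowerSeries.coeff n (hausdorff (G.ellLower n x) (G.ellLower n (G.rot x)))

/-- A sum over the path from `x` to `bar x` is a difference of partial sums starting at the tail,
and both cases of the definition give the same antisymmetric expression. In this form the
contributions at a vertex telescope. -/
theorem ellComp_eq_sub {n : ℕ} (hn : 2 ≤ n) (x : G.Dart) :
    G.ellComp n x = (1 / 3 : ℚ) •
      (∑ j ∈ Finset.range (G.position x), G.corner n (G.boundaryEdge j) -
        ∑ j ∈ Finset.range (G.position (G.bar x)), G.corner n (G.boundaryEdge j)) := by
  have h : ∀ j, PowerSeries.coeff n (hausdorff (G.ellLower n (G.boundaryEdge j))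
      (-G.ellLower n (G.boundaryEdge (j + 1)))) = G.corner n (G.boundaryEdge j) := by
    intro j
    rw [boundaryEdge_succ, ellLower_bar, neg_neg, corner]
  rw [ellComp_of_two_le G hn]
  simp only [pathSum, h]
  split_ifs with hlt
  · rw [Finset.sum_Ico_eq_sub _ hlt.le, neg_smul, ← smul_neg, neg_sub]
  · rw [G.bar_bar, Finset.sum_Ico_eq_sub _ (not_lt.1 hlt), neg_smul, neg_neg]

theorem ellLower_homogeneous {n : ℕ}
    (h : ∀ k < n, ∀ x, G.ellComp k x ∈ tensorDegree g k) (x : G.Dart) :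
    IsHomogeneous (G.ellLower n x) := by
  intro k
  rw [ellLower, PowerSeries.coeff_mk]
  split_ifs with hk
  · exact h k hk x
  · exact zero_mem _

theorem ellComp_mem (n : ℕ) (x : G.Dart) : G.ellComp n x ∈ tensorDegree g n := by
  induction n using Nat.strong_induction_on generalizing x with
  | _ n ih =>
    rcases n with _ | _ | n
    · rw [ellComp_zero]; exact zero_mem _
    · rw [zero_add, ellComp_one, tensorDegree, pow_one]
      exact LinearMap.mem_range_self _ _
    · rw [ellComp_eq_sub G (by omega)]
      have hc : ∀ y, G.corner (n + 2) y ∈ tensorDegree g (n + 2) := fun y =>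
        (G.ellLower_homogeneous ih y).hausdorff (G.ellLower_homogeneous ih _) _
      exact Submodule.smul_mem _ _
        (sub_mem (sum_mem fun j _ => hc _) (sum_mem fun j _ => hc _))

theorem ell_homogeneous (x : G.Dart) : IsHomogeneous (G.ell x) := fun n => by
  rw [ell, PowerSeries.coeff_mk]
  exact G.ellComp_mem n x

theorem coeff_zero_ell (x : G.Dart) : PowerSeries.coeff 0 (G.ell x) = 0 := by
  rw [ell, PowerSeries.coeff_mk, ellComp_zero]

theorem coeff_zero_ellLower (n : ℕ) (x : G.Dart) : PowerSeries.coeff 0 (G.ellLower n x) = 0 := by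
  rw [ellLower, PowerSeries.coeff_mk, ellComp_zero, ite_self]

theorem coeff_ellLower_self (n : ℕ) (x : G.Dart) : PowerSeries.coeff n (G.ellLower n x) = 0 := by
  rw [ellLower, PowerSeries.coeff_mk, if_neg (lt_irrefl n)]

theorem ell_eqUpTo (n : ℕ) (x : G.Dart) : EqUpTo n (G.ell x) (G.ellLower n x) := fun k hk => by
  rw [ell, ellLower, PowerSeries.coeff_mk, PowerSeries.coeff_mk, if_pos hk]

theorem ellComp_vertex_one {e : G.Dart} (he : e ≠ G.bar G.tail) :
    G.ellComp 1 e + G.ellComp 1 (G.rot e) + G.ellComp 1 (G.rot (G.rot e)) = 0 := by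
  rw [ellComp_one, ellComp_one, ellComp_one, ← map_add, ← map_add, ← homologyClass_mul,
    ← homologyClass_mul, G.mark_vertex e he, homologyClass_one, map_zero]

/-- The components of `ℓ` at a trivalent vertex add up to the corner term, provided that it does
not depend on the corner. -/
theorem ellComp_vertex {n : ℕ} (hn : 2 ≤ n) {e : G.Dart} (he : e ≠ G.bar G.tail)
    (hc : ∀ x ≠ G.bar G.tail, G.corner n (G.rot x) = G.corner n x) :
    G.ellComp n e + G.ellComp n (G.rot e) + G.ellComp n (G.rot (G.rot e)) = -G.corner n e := by
  have h1 := G.rot_ne_bar_tail he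
  have h2 := G.rot_ne_bar_tail h1
  have p1 := G.position_bar_rot he
  have p2 := G.position_bar_rot h1
  have p3 := G.position_bar_rot h2
  rw [G.trivalent e he] at p3
  rw [ellComp_eq_sub G hn, ellComp_eq_sub G hn, ellComp_eq_sub G hn, p1, p2, p3,
    Finset.sum_range_succ, Finset.sum_range_succ, Finset.sum_range_succ, boundaryEdge_position,
    boundaryEdge_position, boundaryEdge_position, hc _ h1, hc _ he]
  module

/-- Induction on the degree. Truncating `ℓ` below degree `j` leaves a defect in degree `j` equal to
the corner term; restoring `ℓ_j` adds the sum of the three `ℓ_j`, which is minus the corner term.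
The induction must treat all vertices at once, since `ellComp_vertex` is applied with corner
independence at every trivalent vertex. -/
theorem expSeries_vertex_eqUpTo (n : ℕ) {e : G.Dart} (he : e ≠ G.bar G.tail) :
    EqUpTo n (expSeries (G.ell e) * expSeries (G.ell (G.rot e)) *
      expSeries (G.ell (G.rot (G.rot e)))) 1 := by
  induction n generalizing e with
  | zero => exact fun j hj => absurd hj (by omega)
  | succ n ih =>
    intro j hj
    rcases Nat.lt_succ_iff_lt_or_eq.1 hj with h1 | rfl
    · exact ih he j h1
    rcases Nat.eq_zero_or_pos j with rfl | hpos
    · simp only [coeff_zero_mul_series, coeff_zero_expSeries, mul_one]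
      simp
    have hj0 : j ≠ 0 := hpos.ne'
    rw [PowerSeries.coeff_one, if_neg hj0]
    have hE := fun x => (G.ell_eqUpTo j x).expSeries
    have hE0 := fun x => coeff_zero_expSeries (G.ell x)
    have hL0 := fun x => coeff_zero_expSeries (G.ellLower j x)
    have hL : ∀ x ≠ G.bar G.tail, EqUpTo j (expSeries (G.ellLower j x) *
        expSeries (G.ellLower j (G.rot x)) * expSeries (G.ellLower j (G.rot (G.rot x)))) 1 :=
      fun x hx => (((hE x).mul (hE _)).mul (hE _)).symm.trans (ih hx)
    have hP : ∀ x ≠ G.bar G.tail, PowerSeries.coeff j (expSeries (G.ellLower j x) *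
        expSeries (G.ellLower j (G.rot x)) * expSeries (G.ellLower j (G.rot (G.rot x)))) =
        G.corner j x := fun x hx =>
      coeff_mul_exp_eq_hausdorff hj0 (G.coeff_zero_ellLower j _) (G.coeff_ellLower_self j _)
        (G.coeff_ellLower_self j _) (G.coeff_ellLower_self j _) (hL x hx)
    -- The triple products at consecutive corners of a vertex are cyclic rotations of each other and
    -- are trivial below degree `j`.
    have hcorner : ∀ x ≠ G.bar G.tail, G.corner j (G.rot x) = G.corner j x := by
      intro x hx
      have a := hL x hx
      have b := hL _ (G.rot_ne_bar_tail hx)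
      rw [← hP x hx, ← hP _ (G.rot_ne_bar_tail hx)]
      rw [G.trivalent x hx] at b ⊢
      rw [mul_assoc] at a
      rw [mul_assoc (expSeries (G.ellLower j x))]
      exact coeff_mul_rotate hj0 (hL0 x) a b
    have hsub : ∀ x, PowerSeries.coeff j (expSeries (G.ell x)) -
        PowerSeries.coeff j (expSeries (G.ellLower j x)) = G.ellComp j x := by
      intro x
      rw [(G.ell_eqUpTo j x).coeff_expSeries_sub hj0 (G.coeff_zero_ell x)
        (G.coeff_zero_ellLower j x), coeff_ellLower_self, sub_zero, ell, PowerSeries.coeff_mk]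
    have key := ((hE e).mul (hE (G.rot e))).coeff_mul_sub (hE (G.rot (G.rot e))) (hE0 _)
      (by rw [coeff_zero_mul_series, hL0, hL0, one_mul])
    rw [(hE e).coeff_mul_sub (hE (G.rot e)) (hE0 _) (hL0 _), hsub, hsub, hsub, hP e he] at key
    rw [eq_add_of_sub_eq key]
    -- Degree `1` lies outside the recursion: there the truncations vanish and the relation is that
    -- of the marking in homology.
    rcases Nat.lt_or_ge j 2 with h2 | h2
    · obtain rfl : j = 1 := by omega
      have h0 : ∀ x, G.ellLower 1 x = 0 := fun x => by
        ext k
        rw [ellLower, PowerSeries.coeff_mk, map_zero]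
        split_ifs with hk
        · obtain rfl : k = 0 := by omega
          exact G.ellComp_zero x
        · rfl
      rw [G.ellComp_vertex_one he, zero_add, ← hP e he, h0, h0, h0, expSeries_zero]
      simp [PowerSeries.coeff_one]
    · rw [G.ellComp_vertex h2 he hcorner, neg_add_cancel]

/-- The exponential of `ℓ` satisfies the vertex relations. -/
theorem expSeries_vertex {e : G.Dart} (he : e ≠ G.bar G.tail) :
    expSeries (G.ell e) * expSeries (G.ell (G.rot e)) *
      expSeries (G.ell (G.rot (G.rot e))) = 1 := by
  ext n
  exact G.expSeries_vertex_eqUpTo (n + 1) he n (Nat.lt_succ_self n)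

theorem expSeries_bar (x : G.Dart) :
    expSeries (G.ell (G.bar x)) * expSeries (G.ell x) = 1 := by
  rw [ell_bar, expSeries_neg_mul (G.coeff_zero_ell x)]

end MarkedFatgraph

/-! ### Functions constant on the cycles of a permutation. -/

section Invariants

variable {D : Type*} [Finite D]

/-- Functions that are invariant under a permutation. -/
def invariants (σ : Equiv.Perm D) : Submodule ℚ (D → ℚ) where
  carrier := {β | ∀ x, β (σ x) = β x}
  add_mem' := fun ha hb x => by simp [ha x, hb x]
  zero_mem' := fun _ => rfl
  smul_mem' := fun c _ ha x => by simp [ha x]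

theorem finrank_invariants (σ : Equiv.Perm D) :
    Module.finrank ℚ (invariants σ) = Nat.card (Quotient (Equiv.Perm.SameCycle.setoid σ)) := by
  classical
  have := Fintype.ofFinite D
  have := Fintype.ofFinite (Quotient (Equiv.Perm.SameCycle.setoid σ))
  have hrange : LinearMap.range (LinearMap.funLeft ℚ ℚ
      (Quotient.mk (Equiv.Perm.SameCycle.setoid σ))) = invariants σ := by
    ext β
    constructor
    · rintro ⟨b, rfl⟩ x
      have : (Quotient.mk (Equiv.Perm.SameCycle.setoid σ) (σ x)) = Quotient.mk _ x :=
        Quotient.sound (Equiv.Perm.sameCycle_apply_left.2 (Equiv.Perm.SameCycle.refl σ x))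
      simp [LinearMap.funLeft_apply, this]
    · intro hβ
      refine ⟨Quotient.lift β fun x y hxy => ?_, rfl⟩
      obtain ⟨n, -, rfl⟩ := Equiv.Perm.SameCycle.exists_pow_eq' hxy
      clear hxy
      induction n with
      | zero => rfl
      | succ n ih => rw [pow_succ', Equiv.Perm.mul_apply, hβ, ih]
  rw [← hrange, LinearMap.finrank_range_of_inj
    (LinearMap.funLeft_injective_of_surjective ℚ ℚ _ Quotient.mk_surjective),
    Module.finrank_fintype_fun_eq_card, Nat.card_eq_fintype_card]

theorem card_eq_two_mul_card_quotient {σ : Equiv.Perm D} (h2 : ∀ x, σ (σ x) = x)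
    (hne : ∀ x, σ x ≠ x) :
    Nat.card D = 2 * Nat.card (Quotient (Equiv.Perm.SameCycle.setoid σ)) := by
  classical
  have := Fintype.ofFinite D
  have := Fintype.ofFinite (Quotient (Equiv.Perm.SameCycle.setoid σ))
  rw [Nat.card_eq_fintype_card, Nat.card_eq_fintype_card, ← Finset.card_univ,
    Finset.card_eq_sum_card_fiberwise (f := Quotient.mk (Equiv.Perm.SameCycle.setoid σ))
      (t := Finset.univ) (fun _ _ => Finset.mem_coe.2 (Finset.mem_univ _)),
    Finset.sum_const_nat (m := 2), Finset.card_univ, mul_comm]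
  intro q _
  obtain ⟨y, rfl⟩ := Quotient.mk_surjective q
  have : Finset.univ.filter (fun x => Quotient.mk (Equiv.Perm.SameCycle.setoid σ) x =
      Quotient.mk (Equiv.Perm.SameCycle.setoid σ) y) = {y, σ y} := by
    ext x
    simp only [Finset.mem_filter, Finset.mem_univ, true_and, Finset.mem_insert,
      Finset.mem_singleton]
    constructor
    · intro h
      obtain ⟨n, -, rfl⟩ := Equiv.Perm.SameCycle.exists_pow_eq' (Quotient.exact h.symm)
      clear h
      induction n with
      | zero => exact Or.inl rfl
      | succ n ih =>
        rw [pow_succ', Equiv.Perm.mul_apply]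
        rcases ih with h | h <;> rw [h]
        · exact Or.inr rfl
        · exact Or.inl (h2 y)
    · rintro (rfl | rfl)
      · rfl
      · exact Quotient.sound (Equiv.Perm.sameCycle_apply_left.2 (Equiv.Perm.SameCycle.refl σ y))
  rw [this, Finset.card_pair (hne y).symm]

end Invariants

/-! ### Linearized marking relations and characters of the surface group. -/

namespace MarkedFatgraph

variable {g : ℕ} (G : MarkedFatgraph g)

/-- Rational functions on the oriented edges that satisfy the relations of a marking. -/
def cocycles : Submodule ℚ (G.Dart → ℚ) where
  carrier := {α | (∀ e, α (G.bar e) = -α e) ∧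
    ∀ e ≠ G.bar G.tail, α e + α (G.rot e) + α (G.rot (G.rot e)) = 0}
  add_mem' := fun {a b} ha hb => ⟨fun e => by simp [ha.1 e, hb.1 e, add_comm], fun e he => by
    simp only [Pi.add_apply]; linear_combination ha.2 e he + hb.2 e he⟩
  zero_mem' := ⟨fun _ => by simp, fun _ _ => by simp⟩
  smul_mem' := fun c a ha => ⟨fun e => by simp [ha.1 e], fun e he => by
    simp only [Pi.smul_apply, smul_eq_mul]; linear_combination c * ha.2 e he⟩

/-- The relation at the univalent vertex, `3 α(bar tail) = 0`, follows from the others: antisymmetry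
makes the sum of `α` over all oriented edges vanish, so the vertex expressions add up to `0`, and
all but this one are known to vanish. -/
theorem cocycles_vertex {α : G.Dart → ℚ} (hα : α ∈ G.cocycles) (e : G.Dart) :
    α e + α (G.rot e) + α (G.rot (G.rot e)) = 0 := by
  classical
  have := G.finite_dart
  have := Fintype.ofFinite G.Dart
  by_cases he : e = G.bar G.tail
  · have h0 : ∑ x, α x = 0 := by
      have : ∑ x, α x = -∑ x, α x := by
        rw [← Finset.sum_neg_distrib, ← Equiv.sum_comp G.bar]
        exact Finset.sum_congr rfl fun x _ => hα.1 x
      linarith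
    have h1 : ∑ x, (α x + α (G.rot x) + α (G.rot (G.rot x))) = 0 := by
      rw [Finset.sum_add_distrib, Finset.sum_add_distrib,
        Equiv.sum_comp G.rot (fun x => α (G.rot x)), Equiv.sum_comp G.rot α, h0]
      norm_num
    rw [Finset.sum_eq_single (G.bar G.tail) (fun x _ hx => hα.2 x hx) (by simp)] at h1
    rw [he]
    exact h1
  · exact hα.2 e he

/-- Cocycles are orthogonal to the functions of vertices and to the functions of unoriented edges.
With `V` vertices and `E` edges these span dimension at least `V + E - 1` in a space of dimension
`2E`, leaving at most `E - V + 1 = 2g`. -/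
theorem finrank_cocycles_le : Module.finrank ℚ G.cocycles ≤ 2 * g := by
  classical
  have := G.finite_dart
  have := Fintype.ofFinite G.Dart
  have hdisj : Disjoint G.cocycles (invariants G.rot ⊔ invariants G.bar) := by
    rw [Submodule.disjoint_def]
    intro α hα hα'
    obtain ⟨β, hβ, γ, hγ, hsum⟩ := Submodule.mem_sup.1 hα'
    have h1 : ∑ e, α e * β e = 0 := by
      have h3 : ∑ e, (α e + α (G.rot e) + α (G.rot (G.rot e))) * β e = 3 * ∑ e, α e * β e := by
        have a1 : ∑ e, α (G.rot e) * β e = ∑ e, α e * β e := by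
          rw [← Equiv.sum_comp G.rot (fun e => α e * β e)]
          exact Finset.sum_congr rfl fun e _ => by rw [hβ e]
        have a2 : ∑ e, α (G.rot (G.rot e)) * β e = ∑ e, α (G.rot e) * β e := by
          rw [← Equiv.sum_comp G.rot (fun e => α (G.rot e) * β e)]
          exact Finset.sum_congr rfl fun e _ => by rw [hβ e]
        simp only [add_mul, Finset.sum_add_distrib]
        rw [a2, a1]
        ring
      simp only [G.cocycles_vertex hα, zero_mul, Finset.sum_const_zero] at h3
      linarith
    have h2 : ∑ e, α e * γ e = 0 := by
      have : ∑ e, α e * γ e = -∑ e, α e * γ e := by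
        rw [← Finset.sum_neg_distrib, ← Equiv.sum_comp G.bar]
        exact Finset.sum_congr rfl fun e _ => by rw [hα.1 e, hγ e, neg_mul]
      linarith
    -- An element of both subspaces is orthogonal to itself, hence zero over `ℚ`.
    have h3 : ∑ e, α e * α e = 0 := by
      have : ∀ e, α e * α e = α e * β e + α e * γ e := fun e => by
        rw [← mul_add, ← Pi.add_apply, hsum]
      simp only [this, Finset.sum_add_distrib, h1, h2, add_zero]
    funext e
    have := (Finset.sum_eq_zero_iff_of_nonneg (fun e _ => mul_self_nonneg (α e))).1 h3 e
      (Finset.mem_univ e)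
    exact mul_self_eq_zero.1 this
  -- Connectedness: a function invariant under `rot` and `bar` is constant along the boundary cycle,
  -- which contains every oriented edge.
  have hinf : Module.finrank ℚ (invariants G.rot ⊓ invariants G.bar : Submodule ℚ (G.Dart → ℚ))
      ≤ 1 := by
    refine le_trans (Submodule.finrank_mono (t := Submodule.span ℚ {fun _ => 1}) ?_)
      (finrank_span_le_card _ |>.trans (by simp))
    rintro β ⟨hr, hb⟩
    refine Submodule.mem_span_singleton.2 ⟨β G.tail, ?_⟩
    funext e
    obtain ⟨n, rfl⟩ := G.one_boundary e
    change β G.tail * 1 = β (G.boundaryEdge n)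
    induction n with
    | zero => exact mul_one _
    | succ n ih => rw [G.boundaryEdge_succ, hb, hr, ih]
  have h1 := Submodule.finrank_add_finrank_le_of_disjoint hdisj
  have h2 := Submodule.finrank_sup_add_finrank_inf_eq (invariants G.rot) (invariants G.bar)
  rw [finrank_invariants, finrank_invariants] at h2
  rw [Module.finrank_fintype_fun_eq_card, ← Nat.card_eq_fintype_card,
    card_eq_two_mul_card_quotient G.bar_bar G.bar_ne] at h1
  have := G.genus
  omega

/-- The rational character of the surface group with given values on the generators. -/
def character (c : Fin g ⊕ Fin g → ℚ) : SurfaceGroup g →* Multiplicative ℚ :=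
  FreeGroup.lift fun i => Multiplicative.ofAdd (c i)

/-- The values of rational characters on the oriented edges of a marked fatgraph. -/
def characterValues : (Fin g ⊕ Fin g → ℚ) →ₗ[ℚ] (G.Dart → ℚ) where
  toFun c e := (character c (G.mark e)).toAdd
  map_add' c c' := by
    have : character (c + c') = character c * character c' := by
      ext i; simp [character]
    funext e
    rw [this]
    rfl
  map_smul' a c := by
    funext e
    simp only [RingHom.id_apply, Pi.smul_apply]
    induction G.mark e using FreeGroup.induction_on with
    | C1 => simp
    | of i => simp [character]
    | inv_of i _ => simp [character]
    | mul x y hx hy => rw [map_mul, map_mul (character c), toAdd_mul, toAdd_mul, hx, hy, smul_add]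

/-- Every rational function on the oriented edges that satisfies the relations of a marking is
induced by a character of the surface group. -/
theorem exists_character {α : G.Dart → ℚ} (hα : α ∈ G.cocycles) :
    ∃ χ : SurfaceGroup g →* Multiplicative ℚ, ∀ e, (χ (G.mark e)).toAdd = α e := by
  have := G.finite_dart
  have hinj : Function.Injective G.characterValues := by
    refine (injective_iff_map_eq_zero _).2 fun c hc => ?_
    have h1 : character c = 1 := by
      refine MonoidHom.eq_of_eqOn_dense G.mark_full ?_
      rintro _ ⟨e, rfl⟩
      exact Multiplicative.toAdd.injective (congrFun hc e)
    funext i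
    have := congrArg Multiplicative.toAdd (DFunLike.congr_fun h1 (FreeGroup.of i))
    simpa [character] using this
  have hle : LinearMap.range G.characterValues ≤ G.cocycles := by
    rintro _ ⟨c, rfl⟩
    refine ⟨fun e => ?_, fun e he => ?_⟩
    · change (character c (G.mark (G.bar e))).toAdd = -(character c (G.mark e)).toAdd
      rw [G.mark_bar_eq_inv, map_inv, toAdd_inv]
    · have := congrArg (character c) (G.mark_vertex e he)
      rw [map_mul, map_mul, map_one] at this
      exact this
  -- Since the marks generate, the `2g`-dimensional space of characters embeds into the cocycles,
  -- and the dimension bound forces equality.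
  have heq : LinearMap.range G.characterValues = G.cocycles := by
    refine Submodule.eq_of_le_of_finrank_le hle (G.finrank_cocycles_le.trans ?_)
    rw [LinearMap.finrank_range_of_inj hinj, Module.finrank_fintype_fun_eq_card]
    simp [two_mul]
  rw [← heq] at hα
  obtain ⟨c, rfl⟩ := hα
  exact ⟨character c, fun e => rfl⟩

/-! ### Existence and uniqueness of the fatgraph Magnus expansion. -/

/-- The homomorphism induced by the marking on the free group on the oriented edges. -/
def markHom : FreeGroup G.Dart →* SurfaceGroup g := FreeGroup.lift G.mark

theorem markHom_surjective : Function.Surjective G.markHom := by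
  rw [← MonoidHom.range_eq_top, markHom, FreeGroup.range_lift_eq_closure, G.mark_full]

/-- Two homomorphisms to unipotent series that satisfy the relations of a marking agree if they
agree on lifts of the generators of the surface group. -/
theorem hom_eq_of_eq_on_generators {A B : FreeGroup G.Dart →* TensorSeries g}
    (hA : ∀ w, PowerSeries.coeff 0 (A w) = 1) (hB : ∀ w, PowerSeries.coeff 0 (B w) = 1)
    (hbar : ∀ e, A (FreeGroup.of (G.bar e) * FreeGroup.of e) =
      B (FreeGroup.of (G.bar e) * FreeGroup.of e))
    (hvertex : ∀ e ≠ G.bar G.tail,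
      A (FreeGroup.of e * FreeGroup.of (G.rot e) * FreeGroup.of (G.rot (G.rot e))) =
      B (FreeGroup.of e * FreeGroup.of (G.rot e) * FreeGroup.of (G.rot (G.rot e))))
    {p : Fin g ⊕ Fin g → FreeGroup G.Dart} (hp : ∀ i, G.markHom (p i) = FreeGroup.of i)
    (hgen : ∀ i, A (p i) = B (p i)) : A = B := by
  suffices h : ∀ n w, EqUpTo n (A w) (B w) by
    refine MonoidHom.ext fun w => PowerSeries.ext fun n => ?_
    exact h (n + 1) w n (Nat.lt_succ_self n)
  intro n
  induction n with
  | zero => exact fun w j hj => absurd hj (by omega)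
  | succ n ih =>
    intro w j hj
    rcases Nat.lt_succ_iff_lt_or_eq.1 hj with h1 | rfl
    · exact ih w j h1
    -- Linear functionals reduce the vanishing of a tensor to rational values, where the dimension
    -- count applies.
    rw [← sub_eq_zero, ← Module.forall_dual_apply_eq_zero_iff ℚ]
    intro l
    -- The first possibly nonzero difference of two unipotent homomorphisms is additive. It kills
    -- the relators, so it descends to a character of `π₁`, which vanishes on the generators by
    -- `hgen`.
    let δ : FreeGroup G.Dart →* Multiplicative ℚ := MonoidHom.mk'
      (fun w => Multiplicative.ofAdd
        (l (PowerSeries.coeff j (A w) - PowerSeries.coeff j (B w)))) fun x y => by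
        rw [map_mul, map_mul B, (ih x).coeff_mul_sub (ih y) (hA y) (hB x), map_add, ofAdd_add]
    have hδ : ∀ w, (δ w).toAdd =
      l (PowerSeries.coeff j (A w) - PowerSeries.coeff j (B w)) := fun w => rfl
    have hδ0 : ∀ w, A w = B w → (δ w).toAdd = 0 := fun w hw => by
      rw [hδ, hw, sub_self, map_zero]
    obtain ⟨χ, hχ⟩ := G.exists_character (α := fun e => (δ (FreeGroup.of e)).toAdd)
      ⟨fun e => by
        have := hδ0 _ (hbar e)
        rw [map_mul, toAdd_mul] at this
        exact eq_neg_of_add_eq_zero_left this, fun e he => by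
        have := hδ0 _ (hvertex e he)
        rwa [map_mul, map_mul δ, toAdd_mul, toAdd_mul] at this⟩
    have hcomp : δ = χ.comp G.markHom := by
      ext e
      rw [← hχ e]
      simp [markHom]
    have hχ1 : χ = 1 := by
      ext i
      have := hδ0 _ (hgen i)
      rw [hcomp, MonoidHom.comp_apply, hp] at this
      exact this
    rw [← hδ w, hcomp, hχ1]
    rfl

/-- The homomorphism `e ↦ exp ℓ(e)` on the free group on the oriented edges. -/
def expHom : FreeGroup G.Dart →* (TensorSeries g)ˣ :=
  FreeGroup.lift fun e =>
    { val := expSeries (G.ell e)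
      inv := expSeries (G.ell (G.bar e))
      val_inv := by have := G.expSeries_bar (G.bar e); rwa [G.bar_bar] at this
      inv_val := G.expSeries_bar e }

theorem expHom_of (e : G.Dart) :
    (G.expHom (FreeGroup.of e) : TensorSeries g) = expSeries (G.ell e) := by
  simp [expHom]

theorem expHom_inv_of (e : G.Dart) :
    (G.expHom (FreeGroup.of e)⁻¹ : TensorSeries g) = expSeries (G.ell (G.bar e)) := by
  rw [map_inv, expHom, FreeGroup.lift_apply_of]
  rfl

theorem expHom_properties (w : FreeGroup G.Dart) :
    IsHomogeneous (G.expHom w : TensorSeries g) ∧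
      PowerSeries.coeff 0 (G.expHom w : TensorSeries g) = 1 ∧
      PowerSeries.coeff 1 (G.expHom w : TensorSeries g) =
        TensorAlgebra.ι ℚ (homologyClass (G.markHom w)) := by
  have h1 : ∀ e, PowerSeries.coeff 1 (G.ell e) = TensorAlgebra.ι ℚ (homologyClass (G.mark e)) :=
    fun e => by rw [ell, PowerSeries.coeff_mk, ellComp_one]
  induction w using FreeGroup.induction_on with
  | C1 =>
    rw [map_one, map_one, homologyClass_one, map_zero]
    exact ⟨.one, by simp, by simp [PowerSeries.coeff_one]⟩
  | of e =>
    rw [expHom_of]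
    refine ⟨(G.ell_homogeneous e).expSeries, coeff_zero_expSeries _, ?_⟩
    rw [coeff_one_expSeries, h1, markHom, FreeGroup.lift_apply_of]
  | inv_of e _ =>
    rw [expHom_inv_of]
    refine ⟨(G.ell_homogeneous _).expSeries, coeff_zero_expSeries _, ?_⟩
    rw [coeff_one_expSeries, h1, map_inv, markHom, FreeGroup.lift_apply_of, mark_bar_eq_inv]
  | mul x y hx hy =>
    have hx1 : EqUpTo 1 (G.expHom x : TensorSeries g) 1 := fun j hj => by
      obtain rfl : j = 0 := by omega
      rw [hx.2.1]; simp
    have hy1 : EqUpTo 1 (G.expHom y : TensorSeries g) 1 := fun j hj => by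
      obtain rfl : j = 0 := by omega
      rw [hy.2.1]; simp
    have := hx1.coeff_mul_sub hy1 hy.2.1 (by simp)
    rw [map_mul, Units.val_mul, map_mul G.markHom, homologyClass_mul, map_add, ← hx.2.2, ← hy.2.2]
    refine ⟨hx.1.mul hy.1, by rw [coeff_zero_mul_series, hx.2.1, hy.2.1, one_mul], ?_⟩
    simpa [PowerSeries.coeff_one] using this

/-- The fatgraph Magnus expansion exists. -/
theorem exists_isFatgraphMagnus :
    ∃ θ : SurfaceGroup g →* TensorSeries g, G.IsFatgraphMagnus θ := by
  choose p hp using fun i : Fin g ⊕ Fin g => G.markHom_surjective (FreeGroup.of i)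
  -- The only possible candidate: `π₁` is free on its standard generators, so prescribe their values
  -- through chosen words `p i` in the oriented edges. That every edge `e` then goes to `exp ℓ(e)`
  -- is the content of `key`.
  let θ' : SurfaceGroup g →* (TensorSeries g)ˣ := FreeGroup.lift fun i => G.expHom (p i)
  let U : (TensorSeries g)ˣ →* TensorSeries g := Units.coeHom _
  have hθ0 : ∀ x, PowerSeries.coeff 0 (U (θ' x)) = 1 := by
    have : (Units.map (PowerSeries.constantCoeff (R := Tensors g)).toMonoidHom).comp θ' = 1 := by
      ext i
      have := (G.expHom_properties (p i)).2.1
      simpa [θ'] using this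
    intro x
    have := congrArg Units.val (DFunLike.congr_fun this x)
    simpa [U] using this
  have hbar : ∀ e, G.markHom (FreeGroup.of (G.bar e) * FreeGroup.of e) = 1 := fun e => by
    simp [markHom, G.mark_bar]
  have hvertex : ∀ e ≠ G.bar G.tail, G.markHom
      (FreeGroup.of e * FreeGroup.of (G.rot e) * FreeGroup.of (G.rot (G.rot e))) = 1 :=
    fun e he => by simp [markHom, G.mark_vertex e he]
  have key : U.comp G.expHom = (U.comp θ').comp G.markHom := by
    refine G.hom_eq_of_eq_on_generators (fun w => (G.expHom_properties w).2.1)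
      (fun w => hθ0 _) (fun e => ?_) (fun e he => ?_) hp (fun i => ?_)
    · rw [MonoidHom.comp_apply (U.comp θ'), hbar, map_one, MonoidHom.comp_apply]
      simpa [U, expHom_of] using G.expSeries_bar e
    · rw [MonoidHom.comp_apply (U.comp θ'), hvertex e he, map_one, MonoidHom.comp_apply]
      simpa [U, expHom_of] using G.expSeries_vertex he
    · rw [MonoidHom.comp_apply (U.comp θ'), hp]
      simp [θ']
  have hkey : ∀ w, U.comp θ' (G.markHom w) = (G.expHom w : TensorSeries g) :=
    fun w => (DFunLike.congr_fun key w).symm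
  refine ⟨U.comp θ', ⟨fun x => ?_, hθ0, fun x => ?_⟩, fun e => ?_⟩
  · obtain ⟨w, rfl⟩ := G.markHom_surjective x
    rw [hkey]
    exact (G.expHom_properties w).1
  · obtain ⟨w, rfl⟩ := G.markHom_surjective x
    rw [hkey]
    exact (G.expHom_properties w).2.2
  · have := hkey (FreeGroup.of e)
    rwa [expHom_of, markHom, FreeGroup.lift_apply_of] at this

variable {G}

theorem IsFatgraphMagnus.unique {θ θ' : SurfaceGroup g →* TensorSeries g}
    (h : G.IsFatgraphMagnus θ) (h' : G.IsFatgraphMagnus θ') : θ = θ' := by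
  refine MonoidHom.eq_of_eqOn_dense G.mark_full ?_
  rintro _ ⟨e, rfl⟩
  rw [h.2, h'.2]

variable (G)

theorem existsUnique_isFatgraphMagnus :
    ∃! θ : SurfaceGroup g →* TensorSeries g, G.IsFatgraphMagnus θ := by
  obtain ⟨θ, hθ⟩ := G.exists_isFatgraphMagnus
  exact ⟨θ, hθ, fun θ' hθ' => hθ'.unique hθ⟩

theorem isFatgraphMagnus_magnus : G.IsFatgraphMagnus G.magnus :=
  Classical.epsilon_spec G.exists_isFatgraphMagnus

/-! ### Naturality under isomorphisms and Torelli mapping classes. -/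

section Naturality

variable {G} {G' : MarkedFatgraph g} (ψ : G.Dart ≃ G'.Dart)

theorem map_boundaryEdge (hbar : ∀ x, ψ (G.bar x) = G'.bar (ψ x))
    (hrot : ∀ x, ψ (G.rot x) = G'.rot (ψ x)) (j : ℕ) :
    ψ (G.boundaryEdge j) = G'.boundaryEdge j := by
  induction j with
  | zero =>
    have h := hrot (G.bar G.tail)
    rw [G.rot_bar_tail] at h
    have := (G'.univalent_iff _).1 h.symm
    rw [hbar] at this
    exact G'.bar.injective this
  | succ j ih => rw [boundaryEdge_succ, boundaryEdge_succ, hbar, hrot, ih]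

theorem position_map (hbar : ∀ x, ψ (G.bar x) = G'.bar (ψ x))
    (hrot : ∀ x, ψ (G.rot x) = G'.rot (ψ x)) (x : G.Dart) :
    G'.position (ψ x) = G.position x := by
  rw [position, position]
  simp only [← map_boundaryEdge ψ hbar hrot, EmbeddingLike.apply_eq_iff_eq]

/-- `ℓ` depends only on the fatgraph and the homology classes of the marking. -/
theorem ellComp_map (hbar : ∀ x, ψ (G.bar x) = G'.bar (ψ x))
    (hrot : ∀ x, ψ (G.rot x) = G'.rot (ψ x))
    (hmark : ∀ x, homologyClass (G'.mark (ψ x)) = homologyClass (G.mark x)) (n : ℕ) (x : G.Dart) :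
    G'.ellComp n (ψ x) = G.ellComp n x := by
  induction n using Nat.strong_induction_on generalizing x with
  | _ n ih =>
    rcases n with _ | _ | n
    · rw [ellComp_zero, ellComp_zero]
    · rw [zero_add, ellComp_one, ellComp_one, hmark]
    · have hl : ∀ y, G'.ellLower (n + 2) (ψ y) = G.ellLower (n + 2) y := fun y => by
        ext k
        rw [ellLower, ellLower, PowerSeries.coeff_mk, PowerSeries.coeff_mk]
        split_ifs with hk
        · exact ih k hk y
        · rfl
      have hc : ∀ j, G'.corner (n + 2) (G'.boundaryEdge j) =
          G.corner (n + 2) (G.boundaryEdge j) := fun j => by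
        rw [← map_boundaryEdge ψ hbar hrot, corner, corner, ← hrot, hl, hl]
      rw [ellComp_eq_sub G' (by omega), ellComp_eq_sub G (by omega), ← hbar,
        position_map ψ hbar hrot, position_map ψ hbar hrot]
      simp only [hc]

/-- Naturality of the fatgraph Magnus expansion under Torelli mapping classes. -/
theorem magnus_apply_of_iso_act {m : ℕ} (hm : 1 ≤ m) {φ : mappingClassGroup g}
    (hφ : φ ∈ torelli g m) (h : G'.Iso (G.act φ)) (x : SurfaceGroup g) :
    G'.magnus (φ.1 x) = G.magnus x := by
  obtain ⟨ψ, hbar, hrot, hmark⟩ : ∃ ψ : G'.Dart ≃ G.Dart, (∀ y, ψ (G'.bar y) = G.bar (ψ y)) ∧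
    (∀ y, ψ (G'.rot y) = G.rot (ψ y)) ∧ ∀ y, φ.1 (G.mark (ψ y)) = G'.mark y := h
  have hell : ∀ y, G.ell (ψ y) = G'.ell y := fun y => by
    ext n
    rw [ell, ell, PowerSeries.coeff_mk, PowerSeries.coeff_mk]
    refine ellComp_map ψ hbar hrot (fun z => ?_) n y
    rw [← hmark z, homologyClass_of_mem_torelli hm hφ]
  have : G'.magnus.comp φ.1.toMonoidHom = G.magnus := by
    refine MonoidHom.eq_of_eqOn_dense G.mark_full ?_
    rintro _ ⟨e, rfl⟩
    obtain ⟨e, rfl⟩ := ψ.surjective e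
    change G'.magnus (φ.1 (G.mark (ψ e))) = G.magnus (G.mark (ψ e))
    rw [hmark, G'.isFatgraphMagnus_magnus.2, G.isFatgraphMagnus_magnus.2, hell]
  exact DFunLike.congr_fun this x

end Naturality

end MarkedFatgraph

end FatgraphJohnson

end

/-- The first two parts of the conclusion say that `τ_m(φ)` and the fatgraph Magnus expansions
are well defined; the last one is the formula. -/
theorem corollary4p3 (g : ℕ) (hg : 0 < g) (m : ℕ) (hm : 1 ≤ m)
    (φ : FatgraphJohnson.mappingClassGroup g) (hφ : φ ∈ FatgraphJohnson.torelli g m)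
    (k : ℕ) (G : Fin (k + 1) → FatgraphJohnson.MarkedFatgraph g)
    (hW : ∀ i : Fin k, (G i.castSucc).IsWhiteheadMove (G i.succ))
    (hG : (G (Fin.last k)).Iso ((G 0).act φ)) :
    (∃! τ : FatgraphJohnson.Homology g →ₗ[ℚ] FatgraphJohnson.Tensors g,
      FatgraphJohnson.IsJohnson m φ τ) ∧
    (∀ i : Fin (k + 1),
      ∃! θ : FatgraphJohnson.SurfaceGroup g →* FatgraphJohnson.TensorSeries g,
        (G i).IsFatgraphMagnus θ) ∧
    ∀ x : FatgraphJohnson.SurfaceGroup g,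
      FatgraphJohnson.johnson m φ (FatgraphJohnson.homologyClass x) =
        ∑ i : Fin k, ((G i.castSucc).magnusComp (m + 1) x - (G i.succ).magnusComp (m + 1) x) := by
  have hθ := fun i => (G i).isFatgraphMagnus_magnus
  have hτ := FatgraphJohnson.existsUnique_isJohnson (hθ 0).1 hφ
  refine ⟨hτ, fun i => (G i).existsUnique_isFatgraphMagnus, fun x => ?_⟩
  have hsum : ∑ i : Fin k,
      ((G i.castSucc).magnusComp (m + 1) x - (G i.succ).magnusComp (m + 1) x) =
      (G 0).magnusComp (m + 1) x - (G (Fin.last k)).magnusComp (m + 1) x := by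
    -- Telescoping: adding the missing end term to either sum gives the sum over all `k + 1`
    -- fatgraphs.
    rw [Finset.sum_sub_distrib, sub_eq_sub_iff_add_eq_add]
    exact (Fin.sum_univ_castSucc fun i => (G i).magnusComp (m + 1) x).symm.trans
      (Fin.sum_univ_succ fun i => (G i).magnusComp (m + 1) x)
  -- Writing the argument as `φ(y)` lets naturality replace the last expansion at `φ(y)` by the
  -- first one at `y`.
  obtain ⟨y, rfl⟩ := φ.1.surjective x
  rw [hsum, FatgraphJohnson.homologyClass_of_mem_torelli hm hφ,
    (FatgraphJohnson.isJohnson_johnson hτ.exists).apply_homologyClass (hθ 0).1]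
  simp only [FatgraphJohnson.MarkedFatgraph.magnusComp]
  rw [FatgraphJohnson.MarkedFatgraph.magnus_apply_of_iso_act hm hφ hG]
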